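/- For $n\ge 0$ a permutation of size $n$ is a bijection of $[n]$. A permutation $\sigma$ is the \emph{pattern} of a set of elements (points $(i,\pi(i))$) of a permutation $\pi$ if there is a bijection between the elements of $\sigma$ and that set preserving the left-to-right order and the order of values; $\sigma$ is \emph{contained} in $\pi$ if it is the pattern of some set of elements of $\pi$. A \emph{permutation class} is a set of permutations closed downwards under containment, and $\mathrm{Av}(\sigma)$ is the class of permutations not containing $\sigma$. For permutation classes $\mathcal C,\mathcal D$, let $\mathcal C[\mathcal D]$ be the class of all inflations $\sigma[\tau_1,\dots,\tau_k]$ with $\sigma\in\mathcal C$ of size $k$ and $\tau_1,\dots,\tau_k\in\mathcal D$ (each element of $\sigma$ is replaced by an interval with pattern $\tau_i$). The \emph{merge} $\mathcal C_1\odot\dots\odot\mathcal C_k$ of permutation classes is the set of all permutations whose elements can be partitioned into $k$ (possibly empty) parts so that the pattern of the $i$-th part belongs to $\mathcal C_i$; for $k=0$ it consists of the empty permutation only. If $A$ is a set of permutation classes, a class $\mathcal X$ is \emph{$A$-splittable} if $\mathcal X\subseteq\mathcal C_1\odot\dots\odot\mathcal C_k$ for some finite sequence $\mathcal C_1,\dots,\mathcal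 C_k$ of (not necessarily distinct) members of $A$. Let $\mathsf{Sep}$ be the class of separable permutations: the smallest class that contains the permutation of size $1$ and is closed under sum $\oplus$ and skew sum $\ominus$. Let $\mathsf 1$ be the class consisting of the permutation of size $1$ and the empty permutation, and $\mathsf I$, $\mathsf D$ the classes of all increasing and of all decreasing permutations. A class is \emph{representable} if it is $\mathsf 1$ or an iterated inflation $\mathcal L_1[\mathcal L_2[\cdots[\mathcal L_m]\cdots]]$ of classes $\mathcal L_i\in\{\mathsf I,\mathsf D,\mathrm{Av}(213),\mathrm{Av}(312),\mathrm{Av}(132),\mathrm{Av}(231)\}$; every representable class is a subclass of $\mathsf{Sep}$. \textbf{Theorem.} Let $\mathcal X$ be a proper subclass of $\mathsf{Sep}$, and let $A$ be the set of all representable classes that are contained in $\mathcal X$. Then $\mathcal X$ is $A$-splittable. -/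

import Mathlib

namespace PermClass

/-- A finite permutation of arbitrary size `n ≥ 0`: the pair of `n` and a bijection of
`Fin n = {0, …, n - 1}`. -/
abbrev Permutation : Type := Σ n : ℕ, Equiv.Perm (Fin n)

/-- `σ` is the pattern of the elements of `π` at the positions in `S`: the increasing enumeration
of `S` matches the positions of `σ` with those in `S` and preserves the order of the values. -/
def HasPattern (π : Permutation) (S : Set (Fin π.1)) (σ : Permutation) : Prop :=
  ∃ f : Fin σ.1 ↪o Fin π.1, Set.range f = S ∧
    ∀ i j : Fin σ.1, σ.2 i < σ.2 j ↔ π.2 (f i) < π.2 (f j)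

/-- `σ` is contained in `π`. -/
def Contained (σ π : Permutation) : Prop := ∃ S : Set (Fin π.1), HasPattern π S σ

/-- A permutation class: a set of permutations closed downwards under containment. -/
def IsPermClass (C : Set Permutation) : Prop :=
  ∀ π ∈ C, ∀ σ : Permutation, Contained σ π → σ ∈ C

/-- The permutations that contain no element of `F`. -/
def Av (F : Set Permutation) : Set Permutation := {π | ∀ σ ∈ F, ¬ Contained σ π}

/-- The sum `π ⊕ σ`: a copy of `σ` above and to the right of a copy of `π`. -/
def oplus (π σ : Permutation) : Permutation :=
  ⟨π.1 + σ.1, finSumFinEquiv.symm.trans ((Equiv.sumCongr π.2 σ.2).trans finSumFinEquiv)⟩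

/-- The skew sum `π ⊖ σ`: a copy of `σ` below and to the right of a copy of `π`. -/
def ominus (π σ : Permutation) : Permutation :=
  ⟨π.1 + σ.1, finSumFinEquiv.symm.trans ((Equiv.sumCongr π.2 σ.2).trans
    ((Equiv.sumComm _ _).trans (finSumFinEquiv.trans (finCongr (Nat.add_comm _ _)))))⟩

theorem oplus_left (π σ : Permutation) (i : Fin π.1) :
    (((oplus π σ).2 (Fin.castAdd σ.1 i) : Fin (π.1 + σ.1)) : ℕ) = π.2 i := by
  change ((finSumFinEquiv (Equiv.sumCongr π.2 σ.2 (finSumFinEquiv.symm (Fin.castAdd σ.1 i))) :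
    Fin (π.1 + σ.1)) : ℕ) = _
  simp

theorem oplus_right (π σ : Permutation) (i : Fin σ.1) :
    (((oplus π σ).2 (Fin.natAdd π.1 i) : Fin (π.1 + σ.1)) : ℕ) = π.1 + σ.2 i := by
  change ((finSumFinEquiv (Equiv.sumCongr π.2 σ.2 (finSumFinEquiv.symm (Fin.natAdd π.1 i))) :
    Fin (π.1 + σ.1)) : ℕ) = _
  simp

theorem ominus_left (π σ : Permutation) (i : Fin π.1) :
    (((ominus π σ).2 (Fin.castAdd σ.1 i) : Fin (π.1 + σ.1)) : ℕ) = σ.1 + π.2 i := by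
  change ((finSumFinEquiv (Equiv.sumComm _ _ (Equiv.sumCongr π.2 σ.2 (finSumFinEquiv.symm
    (Fin.castAdd σ.1 i)))) : Fin (σ.1 + π.1)) : ℕ) = _
  simp

theorem ominus_right (π σ : Permutation) (i : Fin σ.1) :
    (((ominus π σ).2 (Fin.natAdd π.1 i) : Fin (π.1 + σ.1)) : ℕ) = σ.2 i := by
  change ((finSumFinEquiv (Equiv.sumComm _ _ (Equiv.sumCongr π.2 σ.2 (finSumFinEquiv.symm
    (Fin.natAdd π.1 i)))) : Fin (σ.1 + π.1)) : ℕ) = _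
  simp

/-- The separable permutations: generated from the permutation of size one (and the empty
permutation) by sums and skew sums. -/
inductive IsSeparable : Permutation → Prop
  | empty : IsSeparable ⟨0, 1⟩
  | one : IsSeparable ⟨1, 1⟩
  | oplus {π σ : Permutation} : IsSeparable π → IsSeparable σ → IsSeparable (oplus π σ)
  | ominus {π σ : Permutation} : IsSeparable π → IsSeparable σ → IsSeparable (ominus π σ)

/-- The class of separable permutations. -/
def SepClass : Set Permutation := {π | IsSeparable π}

/-- `ρ` is the inflation `σ[τ₁, …, τₖ]`. The map `b` sends each position of `ρ` to the element of
`σ` whose block it belongs to. The blocks follow each other from left to right as the elements of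
`σ` do, the `i`-th block has pattern `τ i`, and values in distinct blocks compare as the
corresponding values of `σ`. (A block is empty when `τ i` is.) -/
def IsInflation (σ : Permutation) (τ : Fin σ.1 → Permutation) (ρ : Permutation) : Prop :=
  ∃ b : Fin ρ.1 → Fin σ.1, Monotone b ∧
    (∀ i, HasPattern ρ {x | b x = i} (τ i)) ∧
    ∀ x y, b x ≠ b y → (ρ.2 x < ρ.2 y ↔ σ.2 (b x) < σ.2 (b y))

/-- `C[D]`: all inflations of a permutation from `C` by permutations from `D`. -/
def inflate (C D : Set Permutation) : Set Permutation :=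
  {ρ | ∃ σ ∈ C, ∃ τ : Fin σ.1 → Permutation, (∀ i, τ i ∈ D) ∧ IsInflation σ τ ρ}

/-- The merge `C₁ ⊙ ⋯ ⊙ Cₖ`: the permutations whose elements can be partitioned into `k` (possibly
empty) colour classes such that the pattern of the `i`-th one belongs to `Cᵢ`. For `k = 0` it
consists of the empty permutation only. -/
def merge {k : ℕ} (C : Fin k → Set Permutation) : Set Permutation :=
  {π | ∃ c : Fin π.1 → Fin k, ∀ i, ∃ σ ∈ C i, HasPattern π {x | c x = i} σ}

/-- `C` is `A`-splittable: it is contained in a merge of finitely many classes, each of which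
belongs to `A` (repetitions are allowed). -/
def SplittableOver (A : Set (Set Permutation)) (C : Set Permutation) : Prop :=
  ∃ (k : ℕ) (D : Fin k → Set Permutation), (∀ i, D i ∈ A) ∧ C ⊆ merge D

/-- The permutation of size one and the empty permutation. -/
def uni : Set Permutation := {π | π.1 ≤ 1}

/-- The increasing permutations. -/
def increasing : Set Permutation := {π | StrictMono π.2}

/-- The decreasing permutations. -/
def decreasing : Set Permutation := {π | StrictAnti π.2}

/-- The permutation `132`; values are written one less, as elements of `Fin 3`. -/
def p132 : Permutation := ⟨3, ![0, 2, 1], ![0, 2, 1], by decide, by decide⟩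

/-- The permutation `213`. -/
def p213 : Permutation := ⟨3, ![1, 0, 2], ![1, 0, 2], by decide, by decide⟩

/-- The permutation `231`. -/
def p231 : Permutation := ⟨3, ![1, 2, 0], ![2, 0, 1], by decide, by decide⟩

/-- The permutation `312`. -/
def p312 : Permutation := ⟨3, ![2, 0, 1], ![1, 2, 0], by decide, by decide⟩

/-- The alphabet of the words that describe iterated inflations. -/
inductive Letter
  | inc | dec | av213 | av312 | av132 | av231

/-- The class that a letter stands for. -/
def Letter.cl : Letter → Set Permutation
  | .inc => increasing
  | .dec => decreasing
  | .av213 => Av {p213}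
  | .av312 => Av {p312}
  | .av132 => Av {p132}
  | .av231 => Av {p231}

/-- The class represented by a word: the iterated inflation of the classes of its letters. -/
def wordClass : List Letter → Set Permutation
  | [] => uni
  | a :: w => inflate a.cl (wordClass w)

/-- A class is representable if it is represented by some word. -/
def Representable (C : Set Permutation) : Prop := ∃ w : List Letter, wordClass w = C

end PermClass

/-!
Separable permutations are built by the two operations `⊕` and `⊖`, written here as `op true` and
`op false`. A minimal bad sequence argument shows that they are well-quasi-ordered by containment
(`sepClass_partiallyWellOrderedOn`), so their subclasses satisfy the descending chain condition
(`wellFounded_subclasses`), and it may be assumed that every proper subclass `Y` of `X` is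
splittable over the representable subclasses of `Y`. As splittings compose (`Split.sigma`), it is
enough to split `X` into proper subclasses or into representable ones.

* If some `a, b ∈ X` have no common upper bound in `X`, then `X` is the union of `X ∩ Av(a)` and
  `X ∩ Av(b)`.
* If `X` is directed and closed under neither operation, there is one `α ∈ X` such that neither
  `α ⊕ α` nor `α ⊖ α` is in `X`. The nodes of a separation tree that contain `α` then essentially
  form a path, and `X` splits into copies of `X ∩ Av(α)` and the class of the single element
  (`splittableOver_of_not_closed`).
* Otherwise `X` is closed under exactly one operation, say `⊕`. Let `L` and `R` be the classes of
  all `τ` such that `τ ⊖ γ ∈ X`, respectively `γ ⊖ τ ∈ X`, for every `γ ∈ X`. By the descending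
  chain condition a single large `γ = α` suffices to test this (`exists_forall_subset`). At each
  node `a ⊖ b` of a separation tree of a member of `X`, either `a ∈ L`, or `b ∈ R`, or both `a` and
  `b` avoid `α`. Colouring the elements of the subtrees accordingly splits `X` into
  `Av(231)[L]`, `Av(312)[R]` and two copies of `I[X ∩ Av(α)]` (`splittableOver_of_closed`), all of
  them contained in `X` (`inflate_left_subset`, `inflate_right_subset`, `inflate_mid_subset`).
  Since `L`, `R` and `X ∩ Av(α)` are proper subclasses of `X`, they split into word classes, and
  prefixing a letter to these words gives representable subclasses of `X`.

The case of closure under `⊖` is the same with all values reversed; it is treated at the same time,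
with a Boolean `s` that names the operation and the direction in which values are compared.
-/

namespace PermClass

/-! ### Patterns on sets of positions -/

/-- The order of the values (`s = true`) or its reverse (`s = false`). -/
def VLt (s : Bool) {n : ℕ} (x y : Fin n) : Prop := if s then x < y else y < x

@[simp] theorem vLt_true {n : ℕ} (x y : Fin n) : VLt true x y ↔ x < y := by simp [VLt]
@[simp] theorem vLt_false {n : ℕ} (x y : Fin n) : VLt false x y ↔ y < x := by simp [VLt]

theorem vLt_not (s : Bool) {n : ℕ} (x y : Fin n) : VLt (!s) x y ↔ VLt s y x := by
  cases s <;> simp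

theorem VLt.trans {s : Bool} {n : ℕ} {x y z : Fin n} (h : VLt s x y) (h' : VLt s y z) :
    VLt s x z := by
  cases s <;> simp at * <;> order

theorem VLt.asymm {s : Bool} {n : ℕ} {x y : Fin n} (h : VLt s x y) : ¬ VLt s y x := by
  cases s <;> simp at * <;> order

theorem vLt_trichotomy (s : Bool) {n : ℕ} (x y : Fin n) : VLt s x y ∨ x = y ∨ VLt s y x := by
  cases s <;> simp <;> grind

/-- `⊕` for `s = true` and `⊖` for `s = false`. -/
def op : Bool → Permutation → Permutation → Permutation
  | true => oplus
  | false => ominus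

/-- The positions in `op s a b` of the elements of `a`. -/
def inl (s : Bool) (a b : Permutation) : Fin a.1 ↪o Fin (op s a b).1 :=
  match s with
  | true => Fin.castAddOrderEmb b.1
  | false => Fin.castAddOrderEmb b.1

/-- The positions in `op s a b` of the elements of `b`. -/
def inr (s : Bool) (a b : Permutation) : Fin b.1 ↪o Fin (op s a b).1 :=
  match s with
  | true => Fin.natAddOrderEmb a.1
  | false => Fin.natAddOrderEmb a.1

/-- A function on the positions of `op s a b` given by its values on the two parts. -/
def opElim {β : Type*} (s : Bool) (a b : Permutation) (f : Fin a.1 → β) (g : Fin b.1 → β) :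
    Fin (op s a b).1 → β :=
  match s with
  | true => Fin.addCases f g
  | false => Fin.addCases f g

section op
variable {β : Type*} (s : Bool) (a b : Permutation)

@[simp] theorem opElim_inl (f : Fin a.1 → β) (g : Fin b.1 → β) (x : Fin a.1) :
    opElim s a b f g (inl s a b x) = f x := by
  cases s <;> exact Fin.addCases_left (motive := fun _ => β) (left := f) (right := g) x

@[simp] theorem opElim_inr (f : Fin a.1 → β) (g : Fin b.1 → β) (x : Fin b.1) :
    opElim s a b f g (inr s a b x) = g x := by
  cases s <;> exact Fin.addCases_right (motive := fun _ => β) (left := f) (right := g) x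

theorem inl_lt_inr (x : Fin a.1) (y : Fin b.1) : inl s a b x < inr s a b y := by
  cases s
  all_goals
    change Fin.castAdd b.1 x < Fin.natAdd a.1 y
    simp only [Fin.lt_def, Fin.val_castAdd, Fin.val_natAdd]
    omega

theorem inl_or_inr (z : Fin (op s a b).1) : (∃ x, inl s a b x = z) ∨ ∃ y, inr s a b y = z := by
  cases s
  · exact Fin.addCases (m := a.1) (n := b.1)
      (motive := fun z => (∃ x, inl false a b x = z) ∨ ∃ y, inr false a b y = z)
      (fun x => .inl ⟨x, rfl⟩) (fun y => .inr ⟨y, rfl⟩) z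
  · exact Fin.addCases (m := a.1) (n := b.1)
      (motive := fun z => (∃ x, inl true a b x = z) ∨ ∃ y, inr true a b y = z)
      (fun x => .inl ⟨x, rfl⟩) (fun y => .inr ⟨y, rfl⟩) z

theorem op_inl_lt (x y : Fin a.1) :
    (op s a b).2 (inl s a b x) < (op s a b).2 (inl s a b y) ↔ a.2 x < a.2 y := by
  cases s
  · have := ominus_left a b x; have := ominus_left a b y
    simp only [Fin.lt_def]
    change (((ominus a b).2 (Fin.castAdd b.1 x) : Fin (a.1 + b.1)) : ℕ) <
      ((ominus a b).2 (Fin.castAdd b.1 y) : Fin (a.1 + b.1)) ↔ _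
    omega
  · have := oplus_left a b x; have := oplus_left a b y
    simp only [Fin.lt_def]
    change (((oplus a b).2 (Fin.castAdd b.1 x) : Fin (a.1 + b.1)) : ℕ) <
      ((oplus a b).2 (Fin.castAdd b.1 y) : Fin (a.1 + b.1)) ↔ _
    omega

theorem op_inr_lt (x y : Fin b.1) :
    (op s a b).2 (inr s a b x) < (op s a b).2 (inr s a b y) ↔ b.2 x < b.2 y := by
  cases s
  · have := ominus_right a b x; have := ominus_right a b y
    simp only [Fin.lt_def]
    change (((ominus a b).2 (Fin.natAdd a.1 x) : Fin (a.1 + b.1)) : ℕ) <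
      ((ominus a b).2 (Fin.natAdd a.1 y) : Fin (a.1 + b.1)) ↔ _
    omega
  · have := oplus_right a b x; have := oplus_right a b y
    simp only [Fin.lt_def]
    change (((oplus a b).2 (Fin.natAdd a.1 x) : Fin (a.1 + b.1)) : ℕ) <
      ((oplus a b).2 (Fin.natAdd a.1 y) : Fin (a.1 + b.1)) ↔ _
    omega

theorem op_vLt (x : Fin a.1) (y : Fin b.1) :
    VLt s ((op s a b).2 (inl s a b x)) ((op s a b).2 (inr s a b y)) := by
  cases s
  · have := ominus_left a b x; have := ominus_right a b y
    simp only [vLt_false, Fin.lt_def]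
    change (((ominus a b).2 (Fin.natAdd a.1 y) : Fin (a.1 + b.1)) : ℕ) <
      ((ominus a b).2 (Fin.castAdd b.1 x) : Fin (a.1 + b.1))
    omega
  · have := oplus_left a b x; have := oplus_right a b y
    simp only [vLt_true, Fin.lt_def]
    change (((oplus a b).2 (Fin.castAdd b.1 x) : Fin (a.1 + b.1)) : ℕ) <
      ((oplus a b).2 (Fin.natAdd a.1 y) : Fin (a.1 + b.1))
    omega

theorem hasPattern_inl : HasPattern (op s a b) (Set.range (inl s a b)) a :=
  ⟨inl s a b, rfl, fun i j => (op_inl_lt s a b i j).symm⟩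

theorem hasPattern_inr : HasPattern (op s a b) (Set.range (inr s a b)) b :=
  ⟨inr s a b, rfl, fun i j => (op_inr_lt s a b i j).symm⟩

end op

theorem HasPattern.refl (π : Permutation) : HasPattern π Set.univ π :=
  ⟨RelEmbedding.refl _, by simp, fun _ _ => Iff.rfl⟩

theorem hasPattern_empty (π : Permutation) : HasPattern π ∅ ⟨0, 1⟩ :=
  ⟨⟨⟨Fin.elim0, fun i => i.elim0⟩, fun {i} => i.elim0⟩, by simp, fun i => i.elim0⟩

/-- The pattern of a set of elements is unique. -/
theorem HasPattern.unique {π σ τ : Permutation} {S : Set (Fin π.1)}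
    (h : HasPattern π S σ) (h' : HasPattern π S τ) : σ = τ := by
  obtain ⟨n, σ⟩ := σ
  obtain ⟨m, τ⟩ := τ
  obtain ⟨f, hf, hfv⟩ := h
  obtain ⟨g, hg, hgv⟩ := h'
  dsimp only at f g hfv hgv
  have hnm : n = m := by
    have h1 : Set.ncard (Set.range f) = n := by
      rw [← Set.image_univ, Set.ncard_image_of_injective _ f.injective]; simp
    have h2 : Set.ncard (Set.range g) = m := by
      rw [← Set.image_univ, Set.ncard_image_of_injective _ g.injective]; simp
    rw [← h1, ← h2, hf, hg]
  subst hnm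
  have hfg : f = g := by
    apply RelEmbedding.coe_fn_injective
    exact (StrictMono.range_inj f.strictMono g.strictMono).1 (hf.trans hg.symm)
  subst hfg
  have : σ = τ := by
    have hlt : ∀ i j, σ i < σ j ↔ τ i < τ j := fun i j => (hfv i j).trans (hgv i j).symm
    have hm : StrictMono (fun x => τ (σ.symm x)) := by
      intro x y hxy
      exact (hlt _ _).1 (by simpa using hxy)
    have hm' : StrictMono (fun x : Fin n => x) := fun _ _ h => h
    have := (StrictMono.range_inj hm hm').1 (by
      rw [(τ.surjective.comp σ.symm.surjective).range_eq (f := fun x => τ (σ.symm x))]; simp)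
    ext i
    have h := congrFun this (σ i)
    simp at h
    rw [h]
  rw [this]

theorem HasPattern.trans {π σ τ : Permutation} {f : Fin σ.1 ↪o Fin π.1}
    (hf : ∀ i j : Fin σ.1, σ.2 i < σ.2 j ↔ π.2 (f i) < π.2 (f j)) {T : Set (Fin σ.1)}
    (h : HasPattern σ T τ) : HasPattern π (f '' T) τ := by
  obtain ⟨g, rfl, hg⟩ := h
  refine ⟨g.trans f, ?_, fun i j => (hg i j).trans (hf _ _)⟩
  rw [← Set.range_comp]; rfl

theorem Contained.refl (π : Permutation) : Contained π π := ⟨_, .refl π⟩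

theorem Contained.trans {π σ τ : Permutation} (h : Contained π σ) (h' : Contained σ τ) :
    Contained π τ := by
  obtain ⟨T, hT⟩ := h
  obtain ⟨_, f, rfl, hf⟩ := h'
  exact ⟨_, hT.trans hf⟩

theorem contained_empty (π : Permutation) : Contained ⟨0, 1⟩ π := ⟨_, hasPattern_empty π⟩

/-- The elements at the positions in `S` lie to the left of those in `T`, and below them
(`s = true`) or above them (`s = false`). -/
def Below (s : Bool) (π : Permutation) (S T : Set (Fin π.1)) : Prop :=
  ∀ x ∈ S, ∀ y ∈ T, x < y ∧ VLt s (π.2 x) (π.2 y)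

theorem HasPattern.op {s : Bool} {π a b : Permutation} {S T : Set (Fin π.1)}
    (ha : HasPattern π S a) (hb : HasPattern π T b) (h : Below s π S T) :
    HasPattern π (S ∪ T) (op s a b) := by
  obtain ⟨f, rfl, hf⟩ := ha
  obtain ⟨g, rfl, hg⟩ := hb
  have key : ∀ x y, f x < g y ∧ VLt s (π.2 (f x)) (π.2 (g y)) := fun x y =>
    h _ ⟨x, rfl⟩ _ ⟨y, rfl⟩
  have hmono : StrictMono (opElim s a b f g) := by
    intro x y hxy
    rcases inl_or_inr s a b x with ⟨x, rfl⟩ | ⟨x, rfl⟩ <;>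
      rcases inl_or_inr s a b y with ⟨y, rfl⟩ | ⟨y, rfl⟩
    · simpa using hxy
    · simpa using (key x y).1
    · exact absurd hxy (inl_lt_inr s a b y x).asymm
    · simpa using hxy
  refine ⟨OrderEmbedding.ofStrictMono _ hmono, ?_, ?_⟩
  · rw [OrderEmbedding.coe_ofStrictMono]
    ext z
    constructor
    · rintro ⟨x, rfl⟩
      rcases inl_or_inr s a b x with ⟨x, rfl⟩ | ⟨x, rfl⟩ <;> simp
    · rintro (⟨x, rfl⟩ | ⟨x, rfl⟩)
      · exact ⟨inl s a b x, by simp⟩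
      · exact ⟨inr s a b x, by simp⟩
  · intro x y
    rw [OrderEmbedding.coe_ofStrictMono]
    have asymm : ∀ {n m : ℕ} (x y : Fin n) (x' y' : Fin m), VLt s x y → VLt s x' y' →
        (x < y ↔ x' < y') ∧ (y < x ↔ y' < x') := by
      intro n m x y x' y' h h'
      cases s <;> simp at h h' <;> grind
    rcases inl_or_inr s a b x with ⟨x, rfl⟩ | ⟨x, rfl⟩ <;>
      rcases inl_or_inr s a b y with ⟨y, rfl⟩ | ⟨y, rfl⟩
    · simpa [op_inl_lt] using hf x y
    · simpa using (asymm _ _ _ _ (op_vLt s a b x y) (key x y).2).1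
    · simpa using (asymm _ _ _ _ (op_vLt s a b y x) (key y x).2).2
    · simpa [op_inr_lt] using hg x y

theorem HasPattern.vLt {s : Bool} {π σ : Permutation} {f : Fin σ.1 → Fin π.1}
    (hf : ∀ i j : Fin σ.1, σ.2 i < σ.2 j ↔ π.2 (f i) < π.2 (f j)) (i j : Fin σ.1) :
    VLt s (σ.2 i) (σ.2 j) ↔ VLt s (π.2 (f i)) (π.2 (f j)) := by
  cases s <;> simp [hf]

/-- A set of elements has pattern `op s a b` exactly when it is a set with pattern `a` followed by
a set with pattern `b`, in the relative position that `s` prescribes. -/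
theorem hasPattern_op_iff {s : Bool} {π a b : Permutation} {U : Set (Fin π.1)} :
    HasPattern π U (op s a b) ↔
      ∃ S T, HasPattern π S a ∧ HasPattern π T b ∧ Below s π S T ∧ S ∪ T = U := by
  constructor
  · rintro ⟨f, rfl, hf⟩
    refine ⟨_, _, (hasPattern_inl s a b).trans hf, (hasPattern_inr s a b).trans hf, ?_, ?_⟩
    · rintro _ ⟨_, ⟨x, rfl⟩, rfl⟩ _ ⟨_, ⟨y, rfl⟩, rfl⟩
      exact ⟨f.strictMono (inl_lt_inr s a b x y), (HasPattern.vLt hf _ _).1 (op_vLt s a b x y)⟩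
    · have hu : Set.range (inl s a b) ∪ Set.range (inr s a b) = Set.univ :=
        Set.eq_univ_of_forall (inl_or_inr s a b)
      rw [← Set.image_union, hu, Set.image_univ]
  · rintro ⟨S, T, ha, hb, h, rfl⟩
    exact ha.op hb h

theorem op_spec (s : Bool) (a b : Permutation) : ∃ S T, HasPattern (op s a b) S a ∧
    HasPattern (op s a b) T b ∧ Below s (op s a b) S T ∧ S ∪ T = Set.univ :=
  hasPattern_op_iff.1 (.refl _)

theorem empty_op (s : Bool) (a : Permutation) : op s ⟨0, 1⟩ a = a := by
  have h : HasPattern a (∅ ∪ Set.univ) (op s ⟨0, 1⟩ a) :=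
    (hasPattern_empty a).op (.refl a) (by simp [Below])
  rw [Set.empty_union] at h
  exact h.unique (.refl a)

theorem op_empty (s : Bool) (a : Permutation) : op s a ⟨0, 1⟩ = a := by
  have h : HasPattern a (Set.univ ∪ ∅) (op s a ⟨0, 1⟩) :=
    (HasPattern.refl a).op (hasPattern_empty a) (by simp [Below])
  rw [Set.union_empty] at h
  exact h.unique (.refl a)

theorem op_assoc (s : Bool) (a b c : Permutation) :
    op s (op s a b) c = op s a (op s b c) := by
  obtain ⟨S, T, hS, hT, hST, hu⟩ := op_spec s (op s a b) c
  obtain ⟨S₁, S₂, h₁, h₂, h₁₂, rfl⟩ := hasPattern_op_iff.1 hS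
  have h : HasPattern (op s (op s a b) c) (S₁ ∪ (S₂ ∪ T)) (op s a (op s b c)) := by
    refine h₁.op (h₂.op hT fun x hx y hy => hST x (.inr hx) y hy) ?_
    rintro x hx y (hy | hy)
    · exact h₁₂ x hx y hy
    · exact hST x (.inl hx) y hy
  rw [← Set.union_assoc, hu] at h
  exact (HasPattern.refl _).unique h

theorem HasPattern.exists_of_contained {π σ τ : Permutation} {S : Set (Fin π.1)}
    (h : HasPattern π S σ) (h' : Contained τ σ) : ∃ T ⊆ S, HasPattern π T τ := by
  obtain ⟨f, rfl, hf⟩ := h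
  obtain ⟨T, hT⟩ := h'
  exact ⟨_, Set.image_subset_range f T, hT.trans hf⟩

theorem Contained.op {s : Bool} {a b a' b' : Permutation} (ha : Contained a a')
    (hb : Contained b b') : Contained (op s a b) (op s a' b') := by
  obtain ⟨S, T, hS, hT, hST, -⟩ := op_spec s a' b'
  obtain ⟨S', hS', hS''⟩ := hS.exists_of_contained ha
  obtain ⟨T', hT', hT''⟩ := hT.exists_of_contained hb
  exact ⟨_, hS''.op hT'' fun x hx y hy => hST x (hS' hx) y (hT' hy)⟩

theorem contained_op_left (s : Bool) (a b : Permutation) : Contained a (op s a b) :=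
  ⟨_, hasPattern_inl s a b⟩

theorem contained_op_right (s : Bool) (a b : Permutation) : Contained b (op s a b) :=
  ⟨_, hasPattern_inr s a b⟩

theorem op_size (s : Bool) (a b : Permutation) : (op s a b).1 = a.1 + b.1 := by
  cases s <;> rfl

theorem eq_empty_of_size {π : Permutation} (h : π.1 = 0) : π = ⟨0, 1⟩ := by
  obtain ⟨n, p⟩ := π
  dsimp only at h
  subst h
  rw [Subsingleton.elim p 1]

theorem eq_one_of_size {π : Permutation} (h : π.1 = 1) : π = ⟨1, 1⟩ := by
  obtain ⟨n, p⟩ := π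
  dsimp only at h
  subst h
  rw [Subsingleton.elim p 1]

theorem Contained.size_le {σ π : Permutation} (h : Contained σ π) : σ.1 ≤ π.1 := by
  obtain ⟨_, f, -⟩ := h
  simpa using Fintype.card_le_of_injective f f.injective

theorem one_contained {π : Permutation} (h : π.1 ≠ 0) : Contained ⟨1, 1⟩ π := by
  let x : Fin π.1 := ⟨0, Nat.pos_of_ne_zero h⟩
  refine ⟨_, OrderEmbedding.ofStrictMono (fun _ => x) ?_, rfl, ?_⟩
  · intro i j hij
    exact absurd hij (by simp [Subsingleton.elim i j])
  · intro i j
    simp [Subsingleton.elim i j]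

/-! ### Well-quasi-ordering of separable permutations -/

theorem IsSeparable.op {s : Bool} {a b : Permutation} (ha : IsSeparable a) (hb : IsSeparable b) :
    IsSeparable (op s a b) := by
  cases s
  · exact ha.ominus hb
  · exact ha.oplus hb

/-- Structural induction with the two operations treated at once. -/
theorem IsSeparable.op_induction {P : Permutation → Prop} (h0 : P ⟨0, 1⟩) (h1 : P ⟨1, 1⟩)
    (hop : ∀ s a b, IsSeparable a → IsSeparable b → P a → P b → P (PermClass.op s a b))
    {π : Permutation} (h : IsSeparable π) : P π := by
  induction h with
  | empty => exact h0
  | one => exact h1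
  | oplus ha hb iha ihb => exact hop true _ _ ha hb iha ihb
  | ominus ha hb iha ihb => exact hop false _ _ ha hb iha ihb

theorem IsSeparable.cases_op {π : Permutation} (h : IsSeparable π) :
    π = ⟨0, 1⟩ ∨ π = ⟨1, 1⟩ ∨ ∃ s a b, IsSeparable a ∧ IsSeparable b ∧ a.1 ≠ 0 ∧ b.1 ≠ 0 ∧
      π = PermClass.op s a b := by
  refine IsSeparable.op_induction (P := fun π => π = ⟨0, 1⟩ ∨ π = ⟨1, 1⟩ ∨ ∃ s a b,
    IsSeparable a ∧ IsSeparable b ∧ a.1 ≠ 0 ∧ b.1 ≠ 0 ∧ π = PermClass.op s a b)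
    (.inl rfl) (.inr (.inl rfl)) ?_ h
  · intro s a b ha hb iha ihb
    by_cases ha0 : a.1 = 0
    · rw [eq_empty_of_size ha0, empty_op]; exact ihb
    by_cases hb0 : b.1 = 0
    · rw [eq_empty_of_size hb0, op_empty]; exact iha
    exact .inr (.inr ⟨s, a, b, ha, hb, ha0, hb0, rfl⟩)

/-- Separable permutations are well-quasi-ordered by containment. In a minimal bad sequence every
term is a sum or skew sum of smaller permutations, and these smaller ones are
well-quasi-ordered. -/
theorem sepClass_partiallyWellOrderedOn : SepClass.PartiallyWellOrderedOn Contained := by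
  have : IsPreorder Permutation Contained :=
    { refl := Contained.refl, trans := fun _ _ _ => Contained.trans }
  rw [Set.PartiallyWellOrderedOn.iff_not_exists_isMinBadSeq (fun π : Permutation => π.1)]
  rintro ⟨f, ⟨hfS, hbad⟩, hmin⟩
  have h0 : ∀ n, (f n).1 ≠ 0 := fun n hn =>
    hbad n (n + 1) n.lt_succ_self (by rw [eq_empty_of_size hn]; exact contained_empty _)
  have hdec : ∀ n, ∃ s a b, IsSeparable a ∧ IsSeparable b ∧ a.1 ≠ 0 ∧ b.1 ≠ 0 ∧
      f n = op s a b := by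
    intro n
    rcases (hfS n).cases_op with h | h | h
    · exact absurd (by rw [h]) (h0 n)
    · exact absurd (by rw [h]; exact one_contained (h0 _)) (hbad n (n + 1) n.lt_succ_self)
    · exact h
  choose s a b ha hb ha0 hb0 hf using hdec
  have hparts : ({x | ∃ n, x = a n ∨ x = b n} : Set Permutation).PartiallyWellOrderedOn
      Contained := by
    rw [Set.partiallyWellOrderedOn_iff_exists_lt]
    intro g hg
    by_contra! hgbad
    choose φ hφ using hg
    have hgS : ∀ k, g k ∈ SepClass := fun k => by
      rcases hφ k with h | h <;> rw [h]
      exacts [ha _, hb _]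
    have hgf : ∀ k, Contained (g k) (f (φ k)) := fun k => by
      rw [hf]
      rcases hφ k with h | h <;> rw [h]
      exacts [contained_op_left _ _ _, contained_op_right _ _ _]
    have hgsize : ∀ k, (g k).1 < (f (φ k)).1 := fun k => by
      have := ha0 (φ k); have := hb0 (φ k)
      rw [hf, op_size]
      rcases hφ k with h | h <;> rw [h] <;> omega
    -- The term whose parent comes first; the later terms are spliced in at its parent's place.
    obtain ⟨k₀, hk₀⟩ : ∃ k₀, ∀ k, φ k₀ ≤ φ k :=
      ⟨Function.argmin φ, fun k => not_lt.1 (Function.not_lt_argmin φ k)⟩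
    refine hmin (φ k₀) (fun n => if n < φ k₀ then f n else g (k₀ + (n - φ k₀)))
      (fun m hm => (if_pos hm).symm) (by simpa using hgsize k₀) ⟨fun n => ?_, fun m n hmn => ?_⟩
    · dsimp only
      split_ifs
      exacts [hfS _, hgS _]
    · dsimp only
      split_ifs with h1 h2 h2
      · exact hbad m n hmn
      · exact fun h => hbad m _ (h1.trans_le (hk₀ _)) (h.trans (hgf _))
      · omega
      · exact hgbad _ _ (by omega)
  have : IsPreorder (Permutation × Permutation)
      fun x y => Contained x.1 y.1 ∧ Contained x.2 y.2 :=
    { refl := fun x => ⟨.refl _, .refl _⟩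
      trans := fun _ _ _ h h' => ⟨h.1.trans h'.1, h.2.trans h'.2⟩ }
  have hprod := (hparts.prod hparts).prod
    (Set.Finite.partiallyWellOrderedOn (r := (· = ·)) (Set.finite_univ (α := Bool)))
  obtain ⟨m, n, hmn, ⟨h1, h2⟩, h3⟩ := hprod.exists_lt (f := fun n => ((a n, b n), s n))
    (fun n => ⟨⟨⟨n, .inl rfl⟩, ⟨n, .inr rfl⟩⟩, trivial⟩)
  dsimp only at h1 h2 h3
  refine hbad m n hmn ?_
  rw [hf m, hf n, h3]
  exact h1.op h2

/-- The subclasses of the class of separable permutations satisfy the descending chain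
condition. -/
theorem wellFounded_subclasses :
    WellFounded fun X Y : {X : Set Permutation // IsPermClass X ∧ X ⊆ SepClass} =>
      X.1 ⊂ Y.1 := by
  rw [wellFounded_iff_isEmpty_descending_chain]
  refine ⟨fun ⟨C, hC⟩ => ?_⟩
  have hC' : Antitone fun n => (C n).1 := antitone_nat_of_succ_le fun n => (hC n).subset
  choose x hx hx' using fun n => Set.exists_of_ssubset (hC n)
  obtain ⟨m, n, hmn, h⟩ := sepClass_partiallyWellOrderedOn.exists_lt (f := x)
    fun n => (C n).2.2 (hx n)
  exact hx' m ((C (m + 1)).2.1 _ (hC' (Nat.succ_le_of_lt hmn) (hx n)) _ h)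

/-! ### Splittings -/

/-- The elements of `π` at the positions in `S` can be coloured by `ι` so that `f i` is the pattern
of the colour class `i`. -/
def SplitOn {ι : Type*} (π : Permutation) (S : Set (Fin π.1)) (f : ι → Permutation) : Prop :=
  ∃ P : ι → Set (Fin π.1), (∀ i, HasPattern π (P i) (f i)) ∧ Pairwise (Function.onFun Disjoint P) ∧
    ⋃ i, P i = S

/-- The elements of `π` can be coloured by `ι` so that `f i` is the pattern of the colour
class `i`. -/
def Split {ι : Type*} (π : Permutation) (f : ι → Permutation) : Prop := SplitOn π Set.univ f

theorem HasPattern.splitOn {ι : Type*} {π σ : Permutation} {S : Set (Fin π.1)}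
    {f : ι → Permutation} (h : HasPattern π S σ) (h' : Split σ f) : SplitOn π S f := by
  obtain ⟨g, rfl, hg⟩ := h
  obtain ⟨P, hP, hd, hu⟩ := h'
  refine ⟨fun i => g '' P i, fun i => (hP i).trans hg, fun i j hij => ?_, ?_⟩
  · exact Set.disjoint_image_of_injective g.injective (hd hij)
  · rw [← Set.image_iUnion, hu, Set.image_univ]

theorem Split.op {ι : Type*} {a b : Permutation} {f g : ι → Permutation} (s : Bool)
    (ha : Split a f) (hb : Split b g) : Split (op s a b) fun i => op s (f i) (g i) := by
  obtain ⟨S, T, hS, hT, hST, hu⟩ := op_spec s a b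
  obtain ⟨P, hP, hPd, rfl⟩ := hS.splitOn ha
  obtain ⟨Q, hQ, hQd, rfl⟩ := hT.splitOn hb
  have hlt : ∀ i j, ∀ x ∈ P i, ∀ y ∈ Q j, x < y ∧ _ := fun i j x hx y hy =>
    hST x (Set.mem_iUnion_of_mem i hx) y (Set.mem_iUnion_of_mem j hy)
  have hPQ : ∀ i j, Disjoint (P i) (Q j) := fun i j => by
    rw [Set.disjoint_left]
    exact fun x hx hy => (hlt i j x hx x hy).1.false
  refine ⟨fun i => P i ∪ Q i, fun i => (hP i).op (hQ i) (hlt i i), fun i j hij => ?_, ?_⟩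
  · change Disjoint (P i ∪ Q i) (P j ∪ Q j)
    simp only [Set.disjoint_union_left, Set.disjoint_union_right]
    exact ⟨⟨hPd hij, (hPQ j i).symm⟩, hPQ i j, hQd hij⟩
  · rw [Set.iUnion_union_distrib, hu]

theorem Split.contained {ι : Type*} {π : Permutation} {f : ι → Permutation} (h : Split π f)
    (i : ι) : Contained (f i) π := by
  obtain ⟨P, hP, -⟩ := h
  exact ⟨_, hP i⟩

theorem Split.sigma {ι : Type*} {κ : ι → Type*} {π : Permutation} {f : ι → Permutation}
    {g : ∀ i, κ i → Permutation} (h : Split π f) (h' : ∀ i, Split (f i) (g i)) :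
    Split π fun p : Σ i, κ i => g p.1 p.2 := by
  obtain ⟨P, hP, hd, hu⟩ := h
  choose Q hQ hQd hQu using fun i => (hP i).splitOn (h' i)
  refine ⟨fun p => Q p.1 p.2, fun p => hQ p.1 p.2, ?_, ?_⟩
  · rintro ⟨i, k⟩ ⟨j, l⟩ hne
    by_cases hij : i = j
    · subst hij
      exact hQd i fun hkl => hne (congrArg (Sigma.mk i) hkl)
    · refine (hd hij).mono ?_ ?_
      · rw [← hQu]; exact Set.subset_iUnion _ _
      · rw [← hQu]; exact Set.subset_iUnion _ _
  · rw [Set.iUnion_sigma, ← hu]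
    exact Set.iUnion_congr hQu

/-- Colours may be added to a splitting and left unused. -/
theorem Split.extend {ι κ : Type*} {π : Permutation} {f : ι → Permutation} (h : Split π f)
    {e : ι → κ} (he : Function.Injective e) {g : κ → Permutation} (hg : ∀ i, g (e i) = f i)
    (hg' : ∀ k, k ∉ Set.range e → g k = ⟨0, 1⟩) : Split π g := by
  obtain ⟨P, hP, hd, hu⟩ := h
  have hr : ∀ i, ⋃ (j : ι) (_ : e j = e i), P j = P i := fun i => by
    ext x
    simp only [Set.mem_iUnion, exists_prop]
    exact ⟨fun ⟨j, hj, hx⟩ => he hj ▸ hx, fun hx => ⟨i, rfl, hx⟩⟩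
  refine ⟨fun k => ⋃ (i : ι) (_ : e i = k), P i, fun k => ?_, fun k l hkl => ?_, ?_⟩
  · by_cases hk : k ∈ Set.range e
    · obtain ⟨i, rfl⟩ := hk
      dsimp only
      rw [hr, hg]
      exact hP i
    · have : ⋃ (i : ι) (_ : e i = k), P i = ∅ := by
        simp only [Set.iUnion_eq_empty]
        exact fun i hi => absurd ⟨i, hi⟩ hk
      dsimp only
      rw [this, hg' k hk]
      exact hasPattern_empty π
  · change Disjoint (⋃ (i : ι) (_ : e i = k), P i) (⋃ (i : ι) (_ : e i = l), P i)
    simp only [Set.disjoint_iUnion_left, Set.disjoint_iUnion_right]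
    intro i hi j hj
    exact hd fun hij => hkl (by rw [← hi, ← hj, hij])
  · rw [← hu]
    ext x
    simp

theorem split_single {κ : Type*} [DecidableEq κ] (π : Permutation) (k : κ) :
    Split π (Function.update (fun _ => (⟨0, 1⟩ : Permutation)) k π) := by
  have h : Split π fun _ : Unit => π :=
    ⟨fun _ => Set.univ, fun _ => .refl π, fun i j hij => absurd rfl hij, Set.iUnion_const _⟩
  exact h.extend (e := fun _ => k) (fun _ _ _ => rfl) (by simp)
    fun l hl => Function.update_of_ne (fun h => hl ⟨(), h.symm⟩) _ _

theorem Split.sumInl {ι κ : Type*} {π : Permutation} {f : ι → Permutation} (h : Split π f) :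
    Split π (Sum.elim f fun _ : κ => ⟨0, 1⟩) :=
  h.extend (e := Sum.inl) Sum.inl_injective (fun _ => rfl) fun k hk => by
    cases k with
    | inl i => exact absurd ⟨i, rfl⟩ hk
    | inr j => rfl

theorem Split.sumInr {ι κ : Type*} {π : Permutation} {f : κ → Permutation} (h : Split π f) :
    Split π (Sum.elim (fun _ : ι => ⟨0, 1⟩) f) :=
  h.extend (e := Sum.inr) Sum.inr_injective (fun _ => rfl) fun k hk => by
    cases k with
    | inr i => exact absurd ⟨i, rfl⟩ hk
    | inl j => rfl

theorem mem_merge_iff {k : ℕ} {D : Fin k → Set Permutation} {π : Permutation} :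
    π ∈ merge D ↔ ∃ f, (∀ i, f i ∈ D i) ∧ Split π f := by
  constructor
  · rintro ⟨c, hc⟩
    choose f hf hf' using hc
    refine ⟨f, hf, fun i => {x | c x = i}, hf', fun i j hij => ?_, ?_⟩
    · exact Set.disjoint_left.2 fun x hx hy => hij (hx.symm.trans hy)
    · ext x; simp
  · rintro ⟨f, hf, P, hP, hd, hu⟩
    have hex : ∀ x, ∃ i, x ∈ P i := fun x => by simpa using hu.ge (Set.mem_univ x)
    choose c hc using hex
    refine ⟨c, fun i => ⟨f i, hf i, ?_⟩⟩
    convert hP i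
    ext x
    refine ⟨fun hx => hx ▸ hc x, fun hx => ?_⟩
    by_contra hne
    exact Set.disjoint_left.1 (hd hne) (hc x) hx

theorem splittableOver_of_finite {ι : Type*} [Finite ι] {A : Set (Set Permutation)}
    {X : Set Permutation} (D : ι → Set Permutation) (hD : ∀ i, D i ∈ A)
    (h : ∀ π ∈ X, ∃ f : ι → Permutation, (∀ i, f i ∈ D i) ∧ Split π f) : SplittableOver A X := by
  obtain ⟨k, ⟨e⟩⟩ := Finite.exists_equiv_fin ι
  refine ⟨k, fun j => D (e.symm j), fun j => hD _, fun π hπ => ?_⟩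
  obtain ⟨f, hf, hs⟩ := h π hπ
  exact mem_merge_iff.2 ⟨fun j => f (e.symm j), fun j => hf _,
    hs.extend e.injective (by simp) fun k hk => absurd (e.surjective k) hk⟩

/-- Splittability passes from the parts of a merge to the merge. -/
theorem splittableOver_trans {ι : Type*} [Finite ι] {A : Set (Set Permutation)}
    {X : Set Permutation} (D : ι → Set Permutation) (hD : ∀ i, SplittableOver A (D i))
    (h : ∀ π ∈ X, ∃ f : ι → Permutation, (∀ i, f i ∈ D i) ∧ Split π f) : SplittableOver A X := by
  choose k E hE hDE using hD
  refine splittableOver_of_finite (ι := Σ i, Fin (k i)) (fun p => E p.1 p.2)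
    (fun p => hE p.1 p.2) fun π hπ => ?_
  obtain ⟨f, hf, hs⟩ := h π hπ
  choose g hg hgs using fun i => mem_merge_iff.1 (hDE i (hf i))
  exact ⟨fun p => g p.1 p.2, fun p => hg p.1 p.2, hs.sigma hgs⟩

theorem SplittableOver.mono {A B : Set (Set Permutation)} {X : Set Permutation} (hAB : A ⊆ B)
    (h : SplittableOver A X) : SplittableOver B X := by
  obtain ⟨k, D, hD, hX⟩ := h
  exact ⟨k, D, fun i => hAB (hD i), hX⟩

/-! ### The letters and their inflations -/

/-- `231` for `s = true` and `213` for `s = false`. -/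
def leftLetter : Bool → Letter
  | true => .av231
  | false => .av213

/-- `312` for `s = true` and `132` for `s = false`. -/
def rightLetter : Bool → Letter
  | true => .av312
  | false => .av132

/-- The increasing permutations for `s = true`, the decreasing ones for `s = false`. -/
def midLetter : Bool → Letter
  | true => .inc
  | false => .dec

/-- No three elements at positions in `S` form a `231` (`s = true`) or a `213` (`s = false`). -/
def LeftAvoid (s : Bool) (π : Permutation) (S : Set (Fin π.1)) : Prop :=
  ∀ x ∈ S, ∀ y ∈ S, ∀ z ∈ S, x < y → y < z → VLt s (π.2 z) (π.2 x) → ¬ VLt s (π.2 x) (π.2 y)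

/-- No three elements at positions in `S` form a `312` (`s = true`) or a `132` (`s = false`). -/
def RightAvoid (s : Bool) (π : Permutation) (S : Set (Fin π.1)) : Prop :=
  ∀ x ∈ S, ∀ y ∈ S, ∀ z ∈ S, x < y → y < z → VLt s (π.2 y) (π.2 z) → ¬ VLt s (π.2 z) (π.2 x)

/-- The elements at positions in `S` increase (`s = true`) or decrease (`s = false`). -/
def MonoOn (s : Bool) (π : Permutation) (S : Set (Fin π.1)) : Prop :=
  ∀ x ∈ S, ∀ y ∈ S, x < y → VLt s (π.2 x) (π.2 y)

section patterns
variable {s : Bool} {π σ : Permutation} {S T : Set (Fin π.1)}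

theorem HasPattern.leftAvoid_iff (h : HasPattern π S σ) :
    LeftAvoid s σ Set.univ ↔ LeftAvoid s π S := by
  obtain ⟨f, rfl, hf⟩ := h
  simp only [LeftAvoid, Set.forall_mem_range, OrderEmbedding.lt_iff_lt, ← HasPattern.vLt hf,
    Set.mem_univ, forall_const]

theorem HasPattern.rightAvoid_iff (h : HasPattern π S σ) :
    RightAvoid s σ Set.univ ↔ RightAvoid s π S := by
  obtain ⟨f, rfl, hf⟩ := h
  simp only [RightAvoid, Set.forall_mem_range, OrderEmbedding.lt_iff_lt, ← HasPattern.vLt hf,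
    Set.mem_univ, forall_const]

theorem HasPattern.monoOn_iff (h : HasPattern π S σ) :
    MonoOn s σ Set.univ ↔ MonoOn s π S := by
  obtain ⟨f, rfl, hf⟩ := h
  simp only [MonoOn, Set.forall_mem_range, OrderEmbedding.lt_iff_lt, ← HasPattern.vLt hf,
    Set.mem_univ, forall_const]

theorem contained_three_iff (p : Equiv.Perm (Fin 3)) : Contained ⟨3, p⟩ π ↔
    ∃ x y z, x < y ∧ y < z ∧ ∀ i j : Fin 3, p i < p j ↔
      π.2 (![x, y, z] i) < π.2 (![x, y, z] j) := by
  constructor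
  · rintro ⟨_, f, rfl, hf⟩
    refine ⟨f 0, f 1, f 2, f.strictMono (show (0 : Fin 3) < 1 by decide),
      f.strictMono (show (1 : Fin 3) < 2 by decide), fun i j => ?_⟩
    have : ∀ i, ![f 0, f 1, f 2] i = f i := by intro i; fin_cases i <;> rfl
    rw [this, this]
    exact hf i j
  · rintro ⟨x, y, z, hxy, hyz, h⟩
    refine ⟨_, OrderEmbedding.ofStrictMono ![x, y, z] ?_, rfl, h⟩
    intro i j hij
    have := hxy.trans hyz
    fin_cases i <;> fin_cases j <;> simp_all

theorem contained_p231_iff :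
    Contained p231 π ↔ ∃ x y z, x < y ∧ y < z ∧ π.2 z < π.2 x ∧ π.2 x < π.2 y := by
  refine (contained_three_iff _).trans ?_
  refine exists_congr fun x => exists_congr fun y => exists_congr fun z =>
    and_congr_right fun _ => and_congr_right fun _ => ?_
  simp [Fin.forall_fin_succ]
  grind

theorem contained_p213_iff :
    Contained p213 π ↔ ∃ x y z, x < y ∧ y < z ∧ π.2 x < π.2 z ∧ π.2 y < π.2 x := by
  refine (contained_three_iff _).trans ?_
  refine exists_congr fun x => exists_congr fun y => exists_congr fun z =>
    and_congr_right fun _ => and_congr_right fun _ => ?_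
  simp [Fin.forall_fin_succ]
  grind

theorem contained_p312_iff :
    Contained p312 π ↔ ∃ x y z, x < y ∧ y < z ∧ π.2 y < π.2 z ∧ π.2 z < π.2 x := by
  refine (contained_three_iff _).trans ?_
  refine exists_congr fun x => exists_congr fun y => exists_congr fun z =>
    and_congr_right fun _ => and_congr_right fun _ => ?_
  simp [Fin.forall_fin_succ]
  grind

theorem contained_p132_iff :
    Contained p132 π ↔ ∃ x y z, x < y ∧ y < z ∧ π.2 z < π.2 y ∧ π.2 x < π.2 z := by
  refine (contained_three_iff _).trans ?_
  refine exists_congr fun x => exists_congr fun y => exists_congr fun z =>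
    and_congr_right fun _ => and_congr_right fun _ => ?_
  simp [Fin.forall_fin_succ]
  grind

theorem mem_leftLetter : σ ∈ (leftLetter s).cl ↔ LeftAvoid s σ Set.univ := by
  cases s
  · simp [leftLetter, Letter.cl, Av, LeftAvoid, contained_p213_iff]
    exact ⟨fun h x y z hxy hyz => h x y hxy z hyz, fun h x y hxy z hyz => h x y z hxy hyz⟩
  · simp [leftLetter, Letter.cl, Av, LeftAvoid, contained_p231_iff]
    exact ⟨fun h x y z hxy hyz => h x y hxy z hyz, fun h x y hxy z hyz => h x y z hxy hyz⟩

theorem mem_rightLetter : σ ∈ (rightLetter s).cl ↔ RightAvoid s σ Set.univ := by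
  cases s
  · simp [rightLetter, Letter.cl, Av, RightAvoid, contained_p132_iff]
    exact ⟨fun h x y z hxy hyz => h x y hxy z hyz, fun h x y hxy z hyz => h x y z hxy hyz⟩
  · simp [rightLetter, Letter.cl, Av, RightAvoid, contained_p312_iff]
    exact ⟨fun h x y z hxy hyz => h x y hxy z hyz, fun h x y hxy z hyz => h x y z hxy hyz⟩

theorem mem_midLetter : σ ∈ (midLetter s).cl ↔ MonoOn s σ Set.univ := by
  cases s
  · simp [midLetter, Letter.cl, decreasing, MonoOn, StrictAnti]
  · simp [midLetter, Letter.cl, increasing, MonoOn, StrictMono]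

theorem LeftAvoid.union (hS : LeftAvoid s π S) (hT : LeftAvoid s π T) (h : Below s π S T) :
    LeftAvoid s π (S ∪ T) := by
  rintro x (hx | hx) y (hy | hy) z (hz | hz) hxy hyz hzx hxy'
  · exact hS x hx y hy z hz hxy hyz hzx hxy'
  · exact (h x hx z hz).2.asymm hzx
  · exact (h z hz y hy).1.asymm hyz
  · exact (h x hx z hz).2.asymm hzx
  · exact (h y hy x hx).1.asymm hxy
  · exact (h y hy x hx).1.asymm hxy
  · exact (h z hz y hy).1.asymm hyz
  · exact hT x hx y hy z hz hxy hyz hzx hxy'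

theorem RightAvoid.union (hS : RightAvoid s π S) (hT : RightAvoid s π T) (h : Below s π S T) :
    RightAvoid s π (S ∪ T) := by
  rintro x (hx | hx) y (hy | hy) z (hz | hz) hxy hyz hyz' hzx
  · exact hS x hx y hy z hz hxy hyz hyz' hzx
  · exact (h x hx z hz).2.asymm hzx
  · exact (h z hz y hy).1.asymm hyz
  · exact (h x hx z hz).2.asymm hzx
  · exact (h y hy x hx).1.asymm hxy
  · exact (h y hy x hx).1.asymm hxy
  · exact (h z hz y hy).1.asymm hyz
  · exact hT x hx y hy z hz hxy hyz hyz' hzx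

theorem MonoOn.union (hS : MonoOn s π S) (hT : MonoOn s π T) (h : Below s π S T) :
    MonoOn s π (S ∪ T) := by
  rintro x (hx | hx) y (hy | hy) hxy
  · exact hS x hx y hy hxy
  · exact (h x hx y hy).2
  · exact absurd hxy (h y hy x hx).1.asymm
  · exact hT x hx y hy hxy

theorem LeftAvoid.subsingleton_union (hS : S.Subsingleton) (hT : LeftAvoid s π T)
    (h : Below (!s) π S T) : LeftAvoid s π (S ∪ T) := by
  rintro x (hx | hx) y (hy | hy) z (hz | hz) hxy hyz hzx hxy'
  · exact hxy.ne (hS hx hy)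
  · exact hxy.ne (hS hx hy)
  · exact (h z hz y hy).1.asymm hyz
  · exact hxy'.asymm ((vLt_not _ _ _).1 (h x hx y hy).2)
  · exact (h y hy x hx).1.asymm hxy
  · exact (h y hy x hx).1.asymm hxy
  · exact (h z hz y hy).1.asymm hyz
  · exact hT x hx y hy z hz hxy hyz hzx hxy'

theorem RightAvoid.union_subsingleton (hS : RightAvoid s π S) (hT : T.Subsingleton)
    (h : Below (!s) π S T) : RightAvoid s π (S ∪ T) := by
  rintro x (hx | hx) y (hy | hy) z (hz | hz) hxy hyz hyz' hzx
  · exact hS x hx y hy z hz hxy hyz hyz' hzx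
  · exact hyz'.asymm ((vLt_not _ _ _).1 (h y hy z hz).2)
  · exact (h z hz y hy).1.asymm hyz
  · exact hyz.ne (hT hy hz)
  · exact (h y hy x hx).1.asymm hxy
  · exact (h y hy x hx).1.asymm hxy
  · exact (h z hz y hy).1.asymm hyz
  · exact hyz.ne (hT hy hz)

theorem HasPattern.subsingleton_of_one (h : HasPattern π S ⟨1, 1⟩) : S.Subsingleton := by
  obtain ⟨f, rfl, -⟩ := h
  rintro _ ⟨i, rfl⟩ _ ⟨j, rfl⟩
  rw [Subsingleton.elim (α := Fin 1) i j]

theorem op_mem_leftLetter {a b : Permutation} (ha : a ∈ (leftLetter s).cl)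
    (hb : b ∈ (leftLetter s).cl) : op s a b ∈ (leftLetter s).cl := by
  obtain ⟨S, T, hS, hT, hST, hu⟩ := op_spec s a b
  rw [mem_leftLetter] at *
  rw [← hu]
  exact (hS.leftAvoid_iff.1 ha).union (hT.leftAvoid_iff.1 hb) hST

theorem op_mem_rightLetter {a b : Permutation} (ha : a ∈ (rightLetter s).cl)
    (hb : b ∈ (rightLetter s).cl) : op s a b ∈ (rightLetter s).cl := by
  obtain ⟨S, T, hS, hT, hST, hu⟩ := op_spec s a b
  rw [mem_rightLetter] at *
  rw [← hu]
  exact (hS.rightAvoid_iff.1 ha).union (hT.rightAvoid_iff.1 hb) hST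

theorem op_mem_midLetter {a b : Permutation} (ha : a ∈ (midLetter s).cl)
    (hb : b ∈ (midLetter s).cl) : op s a b ∈ (midLetter s).cl := by
  obtain ⟨S, T, hS, hT, hST, hu⟩ := op_spec s a b
  rw [mem_midLetter] at *
  rw [← hu]
  exact (hS.monoOn_iff.1 ha).union (hT.monoOn_iff.1 hb) hST

theorem one_op_mem_leftLetter {b : Permutation} (hb : b ∈ (leftLetter s).cl) :
    op (!s) ⟨1, 1⟩ b ∈ (leftLetter s).cl := by
  obtain ⟨S, T, hS, hT, hST, hu⟩ := op_spec (!s) ⟨1, 1⟩ b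
  rw [mem_leftLetter] at *
  rw [← hu]
  exact .subsingleton_union hS.subsingleton_of_one (hT.leftAvoid_iff.1 hb) hST

theorem op_one_mem_rightLetter {a : Permutation} (ha : a ∈ (rightLetter s).cl) :
    op (!s) a ⟨1, 1⟩ ∈ (rightLetter s).cl := by
  obtain ⟨S, T, hS, hT, hST, hu⟩ := op_spec (!s) a ⟨1, 1⟩
  rw [mem_rightLetter] at *
  rw [← hu]
  exact (hS.rightAvoid_iff.1 ha).union_subsingleton hT.subsingleton_of_one hST

end patterns

theorem empty_mem_inflate {C W : Set Permutation} (h : ⟨0, 1⟩ ∈ C) : ⟨0, 1⟩ ∈ inflate C W :=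
  ⟨⟨0, 1⟩, h, fun i => i.elim0, fun i => i.elim0, id, monotone_id, fun i => i.elim0,
    fun i => i.elim0⟩

theorem mem_inflate_one {W : Set Permutation} {a : Permutation} (h : a ∈ W) :
    a ∈ inflate {⟨1, 1⟩} W := by
  refine ⟨⟨1, 1⟩, rfl, fun _ => a, fun _ => h, fun _ => (0 : Fin 1), fun _ _ _ => le_rfl,
    fun i => ?_, fun x y hxy => absurd rfl hxy⟩
  convert HasPattern.refl a
  ext x
  simpa using Subsingleton.elim (α := Fin 1) _ _

theorem inflate_mono {C C' W : Set Permutation} (h : C ⊆ C') : inflate C W ⊆ inflate C' W := by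
  rintro ρ ⟨σ, hσ, τ⟩
  exact ⟨σ, h hσ, τ⟩

/-- Sums of inflations are inflations of sums. -/
theorem op_mem_inflate {s : Bool} {C C' C'' W : Set Permutation} {ρ ρ' : Permutation}
    (h : ρ ∈ inflate C W) (h' : ρ' ∈ inflate C' W) (hC : ∀ σ ∈ C, ∀ σ' ∈ C', op s σ σ' ∈ C'') :
    op s ρ ρ' ∈ inflate C'' W := by
  obtain ⟨σ, hσ, τ, hτ, b, hb, hbτ, hbv⟩ := h
  obtain ⟨σ', hσ', τ', hτ', b', hb', hbτ', hbv'⟩ := h'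
  have ne : ∀ x y, inl s σ σ' x ≠ inr s σ σ' y := fun x y => (inl_lt_inr s σ σ' x y).ne
  refine ⟨_, hC σ hσ σ' hσ', opElim s σ σ' τ τ', fun i => ?_,
    opElim s ρ ρ' (inl s σ σ' ∘ b) (inr s σ σ' ∘ b'), fun x y hxy => ?_, fun i => ?_,
    fun x y => ?_⟩
  · rcases inl_or_inr s σ σ' i with ⟨i, rfl⟩ | ⟨i, rfl⟩
    · simpa using hτ i
    · simpa using hτ' i
  · rcases inl_or_inr s ρ ρ' x with ⟨x, rfl⟩ | ⟨x, rfl⟩ <;>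
      rcases inl_or_inr s ρ ρ' y with ⟨y, rfl⟩ | ⟨y, rfl⟩
    · simpa using hb (by simpa using hxy)
    · simpa using (inl_lt_inr s σ σ' _ _).le
    · exact absurd hxy (inl_lt_inr s ρ ρ' y x).not_ge
    · simpa using hb' (by simpa using hxy)
  · rcases inl_or_inr s σ σ' i with ⟨i, rfl⟩ | ⟨i, rfl⟩
    · rw [opElim_inl]
      convert (hbτ i).trans fun i j => (op_inl_lt s ρ ρ' i j).symm
      ext x
      rcases inl_or_inr s ρ ρ' x with ⟨x, rfl⟩ | ⟨x, rfl⟩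
      · simp
      · simp [(ne _ _).symm, (inl_lt_inr s ρ ρ' _ x).ne]
    · rw [opElim_inr]
      convert (hbτ' i).trans fun i j => (op_inr_lt s ρ ρ' i j).symm
      ext x
      rcases inl_or_inr s ρ ρ' x with ⟨x, rfl⟩ | ⟨x, rfl⟩
      · simp [ne, (inl_lt_inr s ρ ρ' x _).ne']
      · simp
  · have same : ∀ {n m : ℕ} {x y : Fin n} {x' y' : Fin m}, VLt s x y → VLt s x' y' →
        (x < y ↔ x' < y') ∧ (y < x ↔ y' < x') := by
      intro n m x y x' y' h h'
      cases s <;> simp at h h' <;> grind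
    rcases inl_or_inr s ρ ρ' x with ⟨x, rfl⟩ | ⟨x, rfl⟩ <;>
      rcases inl_or_inr s ρ ρ' y with ⟨y, rfl⟩ | ⟨y, rfl⟩
    · simpa [op_inl_lt] using hbv x y
    · simpa using fun _ => (same (op_vLt s ρ ρ' x y) (op_vLt s σ σ' _ _)).1
    · simpa using fun _ => (same (op_vLt s ρ ρ' y x) (op_vLt s σ σ' _ _)).2
    · simpa [op_inr_lt] using hbv' x y

section closure
variable {s : Bool} {W : Set Permutation} {a f : Permutation}

theorem empty_mem_left : ⟨0, 1⟩ ∈ inflate (leftLetter s).cl W :=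
  empty_mem_inflate (mem_leftLetter.2 fun x => x.elim0)

theorem empty_mem_right : ⟨0, 1⟩ ∈ inflate (rightLetter s).cl W :=
  empty_mem_inflate (mem_rightLetter.2 fun x => x.elim0)

theorem empty_mem_mid : ⟨0, 1⟩ ∈ inflate (midLetter s).cl W :=
  empty_mem_inflate (mem_midLetter.2 fun x => x.elim0)

theorem op_mem_left (ha : a ∈ inflate (leftLetter s).cl W)
    (hf : f ∈ inflate (leftLetter s).cl W) : op s a f ∈ inflate (leftLetter s).cl W :=
  op_mem_inflate ha hf fun _ h _ h' => op_mem_leftLetter h h'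

theorem op_mem_right (ha : a ∈ inflate (rightLetter s).cl W)
    (hf : f ∈ inflate (rightLetter s).cl W) : op s a f ∈ inflate (rightLetter s).cl W :=
  op_mem_inflate ha hf fun _ h _ h' => op_mem_rightLetter h h'

theorem op_mem_mid (ha : a ∈ inflate (midLetter s).cl W)
    (hf : f ∈ inflate (midLetter s).cl W) : op s a f ∈ inflate (midLetter s).cl W :=
  op_mem_inflate ha hf fun _ h _ h' => op_mem_midLetter h h'

theorem op_not_mem_left (ha : a ∈ W) (hf : f ∈ inflate (leftLetter s).cl W) :
    op (!s) a f ∈ inflate (leftLetter s).cl W :=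
  op_mem_inflate (mem_inflate_one ha) hf fun _ h _ h' => by
    rw [Set.mem_singleton_iff.1 h]
    exact one_op_mem_leftLetter h'

theorem op_not_mem_right (ha : a ∈ W) (hf : f ∈ inflate (rightLetter s).cl W) :
    op (!s) f a ∈ inflate (rightLetter s).cl W :=
  op_mem_inflate hf (mem_inflate_one ha) fun _ h _ h' => by
    rw [Set.mem_singleton_iff.1 h']
    exact op_one_mem_rightLetter h

theorem mem_mid (ha : a ∈ W) : a ∈ inflate (midLetter s).cl W :=
  inflate_mono (Set.singleton_subset_iff.2 (mem_midLetter.2 fun x _ y _ h =>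
    absurd h (Subsingleton.elim (α := Fin 1) x y).not_lt)) (mem_inflate_one ha)

end closure

section subset
variable {s : Bool} {X W : Set Permutation}

theorem IsInflation.below {σ ρ : Permutation} {b : Fin ρ.1 → Fin σ.1} (hb : Monotone b)
    (hv : ∀ x y, b x ≠ b y → (ρ.2 x < ρ.2 y ↔ σ.2 (b x) < σ.2 (b y))) {S T : Set (Fin σ.1)}
    (h : Below s σ S T) : Below s ρ (b ⁻¹' S) (b ⁻¹' T) := by
  intro x hx y hy
  obtain ⟨hlt, hval⟩ := h _ hx _ hy
  refine ⟨hb.reflect_lt hlt, ?_⟩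
  cases s <;> simp at hval ⊢
  · exact (hv _ _ hlt.ne').2 hval
  · exact (hv _ _ hlt.ne).2 hval

/-- The first entry of a permutation that avoids `231` splits the rest into the smaller entries,
which all come first, and the larger ones; so inflations of such permutations are obtained from
the empty permutation by the operations under which `X` is closed. -/
theorem inflate_left_subset (h0 : ⟨0, 1⟩ ∈ X) (hs : ∀ a ∈ X, ∀ b ∈ X, op s a b ∈ X)
    (hW : ∀ a ∈ W, ∀ b ∈ X, op (!s) a b ∈ X) : inflate (leftLetter s).cl W ⊆ X := by
  rintro ρ ⟨σ, hσ, τ, hτ, b, hb, hbτ, hbv⟩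
  rw [mem_leftLetter] at hσ
  have key : ∀ T : Finset (Fin σ.1), ∃ γ ∈ X, HasPattern ρ (b ⁻¹' T) γ := by
    intro T
    induction T using Finset.strongInduction with | H T ih =>
    rcases T.eq_empty_or_nonempty with rfl | hne
    · exact ⟨_, h0, by simpa using hasPattern_empty ρ⟩
    classical
    set i := T.min' hne with hi
    have hiT : i ∈ T := T.min'_mem hne
    have hmin : ∀ j ∈ T, j ≠ i → i < j := fun j hj hji =>
      lt_of_le_of_ne (T.min'_le j hj) hji.symm
    set T₁ := T.filter fun j => VLt s (σ.2 j) (σ.2 i) with hT₁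
    set T₂ := T.filter fun j => VLt s (σ.2 i) (σ.2 j) with hT₂
    have irr : ¬ VLt s (σ.2 i) (σ.2 i) := fun h => h.asymm h
    have hlt₁ : ∀ j ∈ T₁, i < j := fun j hj => by
      rw [hT₁, Finset.mem_filter] at hj
      exact hmin j hj.1 fun h => irr (h ▸ hj.2)
    have hlt₂ : ∀ j ∈ T₂, i < j := fun j hj => by
      rw [hT₂, Finset.mem_filter] at hj
      exact hmin j hj.1 fun h => irr (h ▸ hj.2)
    obtain ⟨γ₁, hγ₁, hp₁⟩ := ih T₁ (Finset.filter_ssubset.2 ⟨i, hiT, irr⟩)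
    obtain ⟨γ₂, hγ₂, hp₂⟩ := ih T₂ (Finset.filter_ssubset.2 ⟨i, hiT, irr⟩)
    have hb₁ : Below (!s) σ {i} T₁ := by
      rintro _ rfl y hy
      exact ⟨hlt₁ y hy, (vLt_not _ _ _).2 (Finset.mem_filter.1 hy).2⟩
    have hb₂ : Below s σ ({i} ∪ T₁) T₂ := by
      rintro x (rfl | hx) y hy
      · exact ⟨hlt₂ y hy, (Finset.mem_filter.1 hy).2⟩
      · have hx' := (Finset.mem_filter.1 hx).2
        have hy' := (Finset.mem_filter.1 hy).2
        refine ⟨lt_of_not_ge fun hyx => ?_, hx'.trans hy'⟩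
        rcases hyx.lt_or_eq with hyx | rfl
        · exact hσ i trivial y trivial x trivial (hlt₂ y hy) hyx hx' hy'
        · exact hx'.asymm hy'
    refine ⟨_, hs _ (hW _ (hτ i) _ hγ₁) _ hγ₂, ?_⟩
    have := ((hbτ i).op hp₁ (IsInflation.below hb hbv hb₁)).op hp₂
      (IsInflation.below hb hbv hb₂)
    convert this
    ext x
    simp only [Set.mem_preimage, Finset.mem_coe, Set.mem_union, Set.mem_ofPred_eq, hT₁, hT₂,
      Finset.mem_filter]
    constructor
    · intro hx
      rcases vLt_trichotomy s (σ.2 (b x)) (σ.2 i) with h | h | h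
      · exact .inl (.inr ⟨hx, h⟩)
      · exact .inl (.inl (σ.2.injective h))
      · exact .inr ⟨hx, h⟩
    · rintro ((h | h) | h)
      · exact h ▸ hiT
      · exact h.1
      · exact h.1
  obtain ⟨γ, hγ, hp⟩ := key Finset.univ
  rw [Finset.coe_univ, Set.preimage_univ] at hp
  exact hp.unique (.refl ρ) ▸ hγ

/-- The mirror image of `inflate_left_subset`. -/
theorem inflate_right_subset (h0 : ⟨0, 1⟩ ∈ X) (hs : ∀ a ∈ X, ∀ b ∈ X, op s a b ∈ X)
    (hW : ∀ a ∈ W, ∀ b ∈ X, op (!s) b a ∈ X) : inflate (rightLetter s).cl W ⊆ X := by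
  rintro ρ ⟨σ, hσ, τ, hτ, b, hb, hbτ, hbv⟩
  rw [mem_rightLetter] at hσ
  have key : ∀ T : Finset (Fin σ.1), ∃ γ ∈ X, HasPattern ρ (b ⁻¹' T) γ := by
    intro T
    induction T using Finset.strongInduction with | H T ih =>
    rcases T.eq_empty_or_nonempty with rfl | hne
    · exact ⟨_, h0, by simpa using hasPattern_empty ρ⟩
    classical
    set i := T.max' hne with hi
    have hiT : i ∈ T := T.max'_mem hne
    have hmax : ∀ j ∈ T, j ≠ i → j < i := fun j hj hji =>
      lt_of_le_of_ne (T.le_max' j hj) hji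
    set T₁ := T.filter fun j => VLt s (σ.2 j) (σ.2 i) with hT₁
    set T₂ := T.filter fun j => VLt s (σ.2 i) (σ.2 j) with hT₂
    have irr : ¬ VLt s (σ.2 i) (σ.2 i) := fun h => h.asymm h
    have hlt₁ : ∀ j ∈ T₁, j < i := fun j hj => by
      rw [hT₁, Finset.mem_filter] at hj
      exact hmax j hj.1 fun h => irr (h ▸ hj.2)
    have hlt₂ : ∀ j ∈ T₂, j < i := fun j hj => by
      rw [hT₂, Finset.mem_filter] at hj
      exact hmax j hj.1 fun h => irr (h ▸ hj.2)
    obtain ⟨γ₁, hγ₁, hp₁⟩ := ih T₁ (Finset.filter_ssubset.2 ⟨i, hiT, irr⟩)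
    obtain ⟨γ₂, hγ₂, hp₂⟩ := ih T₂ (Finset.filter_ssubset.2 ⟨i, hiT, irr⟩)
    have hb₂ : Below (!s) σ T₂ {i} := by
      rintro x hx _ rfl
      exact ⟨hlt₂ x hx, (vLt_not _ _ _).2 (Finset.mem_filter.1 hx).2⟩
    have hb₁ : Below s σ T₁ (T₂ ∪ {i}) := by
      rintro x hx y (hy | rfl)
      · have hx' := (Finset.mem_filter.1 hx).2
        have hy' := (Finset.mem_filter.1 hy).2
        refine ⟨lt_of_not_ge fun hyx => ?_, hx'.trans hy'⟩
        rcases hyx.lt_or_eq with hyx | rfl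
        · exact hσ y trivial x trivial i trivial hyx (hlt₁ x hx) hx' hy'
        · exact hx'.asymm hy'
      · exact ⟨hlt₁ x hx, (Finset.mem_filter.1 hx).2⟩
    refine ⟨_, hs _ hγ₁ _ (hW _ (hτ i) _ hγ₂), ?_⟩
    have := hp₁.op (hp₂.op (hbτ i) (IsInflation.below hb hbv hb₂))
      (IsInflation.below hb hbv hb₁)
    convert this
    ext x
    simp only [Set.mem_preimage, Finset.mem_coe, Set.mem_union, Set.mem_ofPred_eq, hT₁, hT₂,
      Finset.mem_filter]
    constructor
    · intro hx
      rcases vLt_trichotomy s (σ.2 (b x)) (σ.2 i) with h | h | h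
      · exact .inl ⟨hx, h⟩
      · exact .inr (.inr (σ.2.injective h))
      · exact .inr (.inl ⟨hx, h⟩)
    · rintro (h | h | h)
      · exact h.1
      · exact h.1
      · exact h ▸ hiT
  obtain ⟨γ, hγ, hp⟩ := key Finset.univ
  rw [Finset.coe_univ, Set.preimage_univ] at hp
  exact hp.unique (.refl ρ) ▸ hγ

theorem inflate_mid_subset (h0 : ⟨0, 1⟩ ∈ X) (hs : ∀ a ∈ X, ∀ b ∈ X, op s a b ∈ X)
    (hW : W ⊆ X) : inflate (midLetter s).cl W ⊆ X := by
  rintro ρ ⟨σ, hσ, τ, hτ, b, hb, hbτ, hbv⟩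
  rw [mem_midLetter] at hσ
  have key : ∀ T : Finset (Fin σ.1), ∃ γ ∈ X, HasPattern ρ (b ⁻¹' T) γ := by
    intro T
    induction T using Finset.induction_on_min with
    | empty => exact ⟨_, h0, by simpa using hasPattern_empty ρ⟩
    | insert i T hi ih =>
      obtain ⟨γ, hγ, hp⟩ := ih
      have hbel : Below s σ {i} T := by
        rintro _ rfl y hy
        exact ⟨hi y hy, hσ _ trivial _ trivial (hi y hy)⟩
      refine ⟨_, hs _ (hW (hτ i)) _ hγ, ?_⟩
      convert (hbτ i).op hp (IsInflation.below hb hbv hbel)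
      ext x
      simp
  obtain ⟨γ, hγ, hp⟩ := key Finset.univ
  rw [Finset.coe_univ, Set.preimage_univ] at hp
  exact hp.unique (.refl ρ) ▸ hγ

end subset

/-! ### Proper subclasses -/

theorem isPermClass_inter_av {X : Set Permutation} (hX : IsPermClass X) (α : Permutation) :
    IsPermClass (X ∩ Av {α}) := by
  rintro π ⟨hπ, hα⟩ σ hσ
  refine ⟨hX π hπ σ hσ, fun β hβ h => hα β hβ (h.trans hσ)⟩

theorem mem_av_singleton {α π : Permutation} : π ∈ Av {α} ↔ ¬ Contained α π := by
  simp [Av]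

theorem inter_av_ssubset {X : Set Permutation} {α : Permutation} (hα : α ∈ X) :
    X ∩ Av {α} ⊂ X :=
  Set.inter_subset_left.ssubset_of_mem_notMem hα fun h => mem_av_singleton.1 h.2 (.refl α)

/-- The class of all representable subclasses of `X`. -/
def repSubclasses (X : Set Permutation) : Set (Set Permutation) := {Y | Representable Y ∧ Y ⊆ X}

theorem repSubclasses_mono {X Y : Set Permutation} (h : X ⊆ Y) :
    repSubclasses X ⊆ repSubclasses Y := fun _ hC => ⟨hC.1, hC.2.trans h⟩

theorem splittableOver_of_mem {A : Set (Set Permutation)} {X : Set Permutation} (h : X ∈ A) :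
    SplittableOver A X :=
  splittableOver_of_finite (ι := Unit) (fun _ => X) (fun _ => h) fun π hπ =>
    ⟨fun _ => π, fun _ => hπ, fun _ => Set.univ, fun _ => .refl π, fun _ _ h => absurd rfl h,
      Set.iUnion_const _⟩

/-- The iterated sums (`s = true`) or skew sums (`s = false`) of permutations in `Z`. -/
inductive SumClosure (s : Bool) (Z : Set Permutation) : Permutation → Prop
  | empty : SumClosure s Z ⟨0, 1⟩
  | cons {a x : Permutation} : a ∈ Z → SumClosure s Z x → SumClosure s Z (op s a x)

theorem SumClosure.of_mem {s : Bool} {Z : Set Permutation} {a : Permutation} (h : a ∈ Z) :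
    SumClosure s Z a := by
  have := SumClosure.cons (s := s) h .empty
  rwa [op_empty] at this

theorem SumClosure.op {s : Bool} {Z : Set Permutation} {x y : Permutation}
    (hx : SumClosure s Z x) (hy : SumClosure s Z y) : SumClosure s Z (op s x y) := by
  induction hx with
  | empty => rwa [empty_op]
  | cons ha _ ih => rw [op_assoc]; exact .cons ha ih

/-- An iterated sum of permutations avoiding `α` either avoids `α` or has a shortest tail that
contains `α`; this tail is made of one summand `f 1` and of a shorter tail `f 2`, which both avoid
`α`, and `f 0` is what precedes it. -/
theorem SumClosure.exists_split {s : Bool} {α x : Permutation} {Z : Set Permutation}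
    (hα : α.1 ≠ 0) (hZ : ∀ z ∈ Z, ¬ Contained α z) (hx : SumClosure s Z x) :
    ¬ Contained α x ∨ ∃ f : Fin 3 → Permutation, Split x f ∧ Contained (PermClass.op s (f 0) α) x ∧
      ¬ Contained α (f 1) ∧ ¬ Contained α (f 2) := by
  induction hx with
  | empty => exact .inl fun h => hα (Nat.le_zero.1 h.size_le)
  | @cons a x ha hx ih =>
    rw [or_iff_not_imp_left, not_not]
    intro hax
    by_cases hαx : Contained α x
    · obtain ⟨f, hf, h0, h1, h2⟩ := ih.resolve_left (not_not.2 hαx)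
      refine ⟨_, (split_single a (0 : Fin 3)).op s hf, ?_, ?_, ?_⟩
      · simp only [Function.update_self]
        rw [op_assoc]
        exact (Contained.refl a).op h0
      · simpa [Function.update_of_ne, empty_op] using h1
      · simpa [Function.update_of_ne, empty_op] using h2
    · refine ⟨_, (split_single a (1 : Fin 3)).op s (split_single x (2 : Fin 3)), ?_, ?_, ?_⟩
      · simpa [Function.update_of_ne, empty_op] using hax
      · simpa [Function.update_of_ne, op_empty] using hZ a ha
      · simpa [Function.update_of_ne, empty_op] using hαx

/-- If neither `α ⊕ α` nor `α ⊖ α` is in `X`, then at each node of a separation tree one of the two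
subtrees avoids `α`. Cutting off such a subtree at every node leaves a path that ends at a leaf. The
elements cut off at sums are coloured `some true`, those cut off at skew sums `some false`, and the
leaf gets the colour `none`. -/
theorem exists_split_of_not_closed {X : Set Permutation} (hX : IsPermClass X) {α : Permutation}
    (h : ∀ s, op s α α ∉ X) {π : Permutation} (hπ : IsSeparable π) (hπX : π ∈ X) :
    ∃ f : Option Bool → Permutation, (f none).1 ≤ 1 ∧
      (∀ s, SumClosure s (X ∩ Av {α}) (f (some s))) ∧ Split π f := by
  refine IsSeparable.op_induction (P := fun π => π ∈ X → ∃ f : Option Bool → Permutation,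
    (f none).1 ≤ 1 ∧ (∀ s, SumClosure s (X ∩ Av {α}) (f (some s))) ∧ Split π f)
    ?_ ?_ ?_ hπ hπX
  · exact fun _ => ⟨_, by simp, fun s => by simpa using .empty, split_single _ none⟩
  · exact fun _ => ⟨_, by simp, fun s => by simpa using .empty, split_single _ none⟩
  · intro s a b _ _ iha ihb hab
    have ha : a ∈ X := hX _ hab _ (contained_op_left s a b)
    have hb : b ∈ X := hX _ hab _ (contained_op_right s a b)
    by_cases hαa : Contained α a
    · have hbZ : b ∈ X ∩ Av {α} := ⟨hb, mem_av_singleton.2 fun hαb =>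
        h s (hX _ hab _ (hαa.op hαb))⟩
      obtain ⟨f, hf, hfs, hsp⟩ := iha ha
      refine ⟨_, ?_, fun t => ?_, hsp.op s (split_single b (some s))⟩
      · simpa [op_empty] using hf
      · by_cases hts : t = s
        · subst hts
          simpa using (hfs t).op (.of_mem hbZ)
        · simpa [Function.update_of_ne, hts, op_empty] using hfs t
    · have haZ : a ∈ X ∩ Av {α} := ⟨ha, mem_av_singleton.2 hαa⟩
      obtain ⟨f, hf, hfs, hsp⟩ := ihb hb
      refine ⟨_, ?_, fun t => ?_, (split_single a (some s)).op s hsp⟩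
      · simpa [empty_op] using hf
      · by_cases hts : t = s
        · subst hts
          simpa using SumClosure.cons haZ (hfs t)
        · simpa [Function.update_of_ne, hts, empty_op] using hfs t

theorem splittableOver_of_not_closed {X : Set Permutation} (hX : IsPermClass X)
    (hXS : X ⊆ SepClass) {α : Permutation} (hα : α.1 ≠ 0) (h : ∀ s, op s α α ∉ X)
    {A : Set (Set Permutation)} (hA : SplittableOver A (X ∩ Av {α})) (huni : uni ∈ A) :
    SplittableOver A X := by
  refine splittableOver_trans (ι := Option Bool)
    (fun o => o.elim uni fun s => {x | SumClosure s (X ∩ Av {α}) x} ∩ X) (fun o => ?_)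
    fun π hπ => ?_
  · cases o with
    | none => exact splittableOver_of_mem huni
    | some s =>
      refine splittableOver_trans (ι := Fin 3) (fun _ => X ∩ Av {α}) (fun _ => hA) ?_
      rintro x ⟨hx, hxX⟩
      rcases SumClosure.exists_split hα (fun z hz => mem_av_singleton.1 hz.2) hx with
        hαx | ⟨f, hf, h0, h1, h2⟩
      · refine ⟨_, fun i => ?_, split_single x (0 : Fin 3)⟩
        by_cases hi : i = 0
        · subst hi
          simpa using ⟨hxX, mem_av_singleton.2 hαx⟩
        · rw [Function.update_of_ne hi]
          exact ⟨hX _ hxX _ (contained_empty _), mem_av_singleton.2 fun h =>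
            hα (Nat.le_zero.1 h.size_le)⟩
      · refine ⟨f, fun i => ⟨hX _ hxX _ (hf.contained i), mem_av_singleton.2 ?_⟩, hf⟩
        fin_cases i
        · exact fun h' => h s (hX _ hxX _ ((h'.op (.refl α)).trans h0))
        · exact h1
        · exact h2
  · obtain ⟨f, hf, hfs, hsp⟩ := exists_split_of_not_closed hX h (hXS hπ) hπ
    refine ⟨f, fun o => ?_, hsp⟩
    cases o with
    | none => exact hf
    | some s => exact ⟨hfs s, hX _ hπ _ (hsp.contained _)⟩

/-- Let `X` be closed under `op s`, with `α ∈ X` such that `op (!s) τ α ∈ X` forces `τ ∈ L` and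
`op (!s) α τ ∈ X` forces `τ ∈ R`, where `L` and `R` consist of permutations that may be attached
by `op (!s)` on the left, respectively on the right, to any member of `X`. At a node `op (!s) a b`
of a separation tree, either `α` is contained in `b`, and `a ∈ L`; or it is contained in `a`, and
`b ∈ R`; or both `a` and `b` avoid `α`. The subtrees met in these three ways are coloured by colours
of their own kinds, and the colour classes lie in inflations of the three kinds of letters. -/
theorem splittableOver_of_closed {X : Set Permutation} (hX : IsPermClass X) (hXS : X ⊆ SepClass)
    {s : Bool} (hs : ∀ a ∈ X, ∀ b ∈ X, op s a b ∈ X) {α : Permutation} (hα : α ∈ X)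
    (hα2 : 2 ≤ α.1) {L R : Set Permutation} (hL : ∀ τ ∈ X, op (!s) τ α ∈ X → τ ∈ L)
    (hR : ∀ τ ∈ X, op (!s) α τ ∈ X → τ ∈ R) (hLX : ∀ τ ∈ L, ∀ γ ∈ X, op (!s) τ γ ∈ X)
    (hRX : ∀ τ ∈ R, ∀ γ ∈ X, op (!s) γ τ ∈ X) (hLs : SplittableOver (repSubclasses L) L)
    (hRs : SplittableOver (repSubclasses R) R)
    (hZs : SplittableOver (repSubclasses (X ∩ Av {α})) (X ∩ Av {α})) :
    SplittableOver (repSubclasses X) X := by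
  have h0 : (⟨0, 1⟩ : Permutation) ∈ X := hX _ hα _ (contained_empty _)
  obtain ⟨kL, DL, hDL, hLD⟩ := hLs
  obtain ⟨kR, DR, hDR, hRD⟩ := hRs
  obtain ⟨kZ, DZ, hDZ, hZD⟩ := hZs
  let D : Fin kL ⊕ (Fin kR ⊕ (Fin kZ ⊕ Fin kZ)) → Set Permutation :=
    Sum.elim (fun i => inflate (leftLetter s).cl (DL i))
      (Sum.elim (fun i => inflate (rightLetter s).cl (DR i))
        (Sum.elim (fun i => inflate (midLetter s).cl (DZ i))
          fun i => inflate (midLetter s).cl (DZ i)))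
  have hD0 : ∀ k, ⟨0, 1⟩ ∈ D k := by
    rintro (i | i | i | i)
    exacts [empty_mem_left, empty_mem_right, empty_mem_mid, empty_mem_mid]
  have hDs : ∀ k, ∀ a ∈ D k, ∀ b ∈ D k, op s a b ∈ D k := by
    rintro (i | i | i | i) a ha b hb
    exacts [op_mem_left ha hb, op_mem_right ha hb, op_mem_mid ha hb, op_mem_mid ha hb]
  have hrep : ∀ (l : Letter) {W : Set Permutation}, Representable W → Representable (inflate l.cl W) := by
    rintro l _ ⟨w, rfl⟩
    exact ⟨l :: w, rfl⟩
  refine splittableOver_of_finite D ?_ fun π hπ => ?_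
  · rintro (i | i | i | i)
    · exact ⟨hrep _ (hDL i).1, inflate_left_subset h0 hs fun a ha => hLX a ((hDL i).2 ha)⟩
    · exact ⟨hrep _ (hDR i).1, inflate_right_subset h0 hs fun a ha => hRX a ((hDR i).2 ha)⟩
    · exact ⟨hrep _ (hDZ i).1, inflate_mid_subset h0 hs fun a ha => ((hDZ i).2 ha).1⟩
    · exact ⟨hrep _ (hDZ i).1, inflate_mid_subset h0 hs fun a ha => ((hDZ i).2 ha).1⟩
  have hsmall : ∀ a ∈ X, ¬ Contained α a → ∃ f, (∀ k, f k ∈ D k) ∧ Split a f := by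
    intro a ha haα
    obtain ⟨f, hf, hsp⟩ := mem_merge_iff.1 (hZD ⟨ha, mem_av_singleton.2 haα⟩)
    refine ⟨_, ?_, hsp.sumInl.sumInr.sumInr⟩
    rintro (i | i | i | i)
    exacts [hD0 _, hD0 (.inr (.inl i)), mem_mid (hf i), hD0 (.inr (.inr (.inr i)))]
  refine IsSeparable.op_induction (P := fun π => π ∈ X → ∃ f, (∀ k, f k ∈ D k) ∧ Split π f)
    ?_ ?_ ?_ (hXS hπ) hπ
  · exact fun h => hsmall _ h fun h' => by simpa using hα2.trans h'.size_le
  · exact fun h => hsmall _ h fun h' => by simpa using hα2.trans h'.size_le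
  intro t a b _ _ iha ihb hab
  have ha : a ∈ X := hX _ hab _ (contained_op_left t a b)
  have hb : b ∈ X := hX _ hab _ (contained_op_right t a b)
  obtain ⟨f, hf, hfa⟩ := iha ha
  obtain ⟨g, hg, hgb⟩ := ihb hb
  by_cases hts : t = s
  · subst hts
    exact ⟨_, fun k => hDs k _ (hf k) _ (hg k), hfa.op t hgb⟩
  obtain rfl : t = !s := Bool.eq_not_iff.2 hts
  by_cases hαb : Contained α b
  · obtain ⟨f', hf', hsp⟩ := mem_merge_iff.1
      (hLD (hL a ha (hX _ hab _ ((Contained.refl a).op hαb))))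
    refine ⟨_, ?_, hsp.sumInl.op (!s) hgb⟩
    rintro (i | k)
    · exact op_not_mem_left (hf' i) (hg (.inl i))
    · simpa [empty_op] using hg (.inr k)
  by_cases hαa : Contained α a
  · obtain ⟨g', hg', hsp⟩ := mem_merge_iff.1
      (hRD (hR b hb (hX _ hab _ (hαa.op (.refl b)))))
    refine ⟨_, ?_, hfa.op (!s) hsp.sumInl.sumInr⟩
    rintro (i | i | k)
    · simpa [op_empty] using hf (.inl i)
    · exact op_not_mem_right (hg' i) (hf (.inr (.inl i)))
    · simpa [op_empty] using hf (.inr (.inr k))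
  · obtain ⟨f', hf', hfsp⟩ := mem_merge_iff.1 (hZD ⟨ha, mem_av_singleton.2 hαa⟩)
    obtain ⟨g', hg', hgsp⟩ := mem_merge_iff.1 (hZD ⟨hb, mem_av_singleton.2 hαb⟩)
    refine ⟨_, ?_, hfsp.sumInl.sumInr.sumInr.op (!s) hgsp.sumInr.sumInr.sumInr⟩
    rintro (i | i | i | i)
    · simpa [empty_op] using hD0 (.inl i)
    · simpa [empty_op] using hD0 (.inr (.inl i))
    · simpa [op_empty] using show f' i ∈ D (.inr (.inr (.inl i))) from mem_mid (hf' i)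
    · simpa [empty_op] using show g' i ∈ D (.inr (.inr (.inr i))) from mem_mid (hg' i)

/-- A downward directed family of subclasses of the separable permutations has a least member. -/
theorem exists_forall_subset {X : Set Permutation} (hne : X.Nonempty)
    (hdir : ∀ a ∈ X, ∀ b ∈ X, ∃ c ∈ X, Contained a c ∧ Contained b c)
    {F : Permutation → Set Permutation} (hF : ∀ γ ∈ X, IsPermClass (F γ) ∧ F γ ⊆ SepClass)
    (hanti : ∀ γ γ', Contained γ γ' → F γ' ⊆ F γ) : ∃ α ∈ X, ∀ γ ∈ X, F α ⊆ F γ := by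
  obtain ⟨x, hx⟩ := hne
  obtain ⟨⟨_, _⟩, ⟨α, hα, rfl⟩, hmin⟩ := wellFounded_subclasses.has_min
    {C | ∃ γ ∈ X, C.1 = F γ} ⟨⟨F x, hF x hx⟩, x, hx, rfl⟩
  refine ⟨α, hα, fun γ hγ => ?_⟩
  obtain ⟨c, hc, hαc, hγc⟩ := hdir α hα γ hγ
  have : ¬ F c ⊂ F α := hmin ⟨F c, hF c hc⟩ ⟨c, hc, rfl⟩
  have hαF : F α ⊆ F c := by
    by_contra h
    exact this ⟨hanti _ _ hαc, h⟩
  exact hαF.trans (hanti _ _ hγc)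

theorem splittableOver_of_subclasses {X : Set Permutation} (hX : IsPermClass X)
    (hXS : X ⊂ SepClass)
    (ih : ∀ Y, IsPermClass Y → Y ⊂ X → SplittableOver (repSubclasses Y) Y) :
    SplittableOver (repSubclasses X) X := by
  by_cases h1 : (⟨1, 1⟩ : Permutation) ∈ X
  swap
  · refine splittableOver_of_finite (ι := Empty) Empty.elim (fun i => i.elim) fun π hπ => ?_
    have hπ0 : π.1 = 0 := by
      by_contra h
      exact h1 (hX π hπ _ (one_contained h))
    rw [eq_empty_of_size hπ0]
    exact ⟨Empty.elim, fun i => i.elim, Empty.elim, fun i => i.elim, fun i => i.elim,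
      Set.ext fun x => Fin.elim0 x⟩
  have h0 : (⟨0, 1⟩ : Permutation) ∈ X := hX _ h1 _ (contained_empty _)
  have huni : uni ∈ repSubclasses X := by
    refine ⟨⟨[], rfl⟩, fun π (hπ : π.1 ≤ 1) => ?_⟩
    rcases Nat.le_one_iff_eq_zero_or_eq_one.1 hπ with h | h
    · rwa [eq_empty_of_size h]
    · rwa [eq_one_of_size h]
  have hav : ∀ α ∈ X, SplittableOver (repSubclasses (X ∩ Av {α})) (X ∩ Av {α}) := fun α hα =>
    ih _ (isPermClass_inter_av hX α) (inter_av_ssubset hα)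
  have hav' : ∀ α ∈ X, SplittableOver (repSubclasses X) (X ∩ Av {α}) := fun α hα =>
    (hav α hα).mono (repSubclasses_mono Set.inter_subset_left)
  by_cases hdir : ∀ a ∈ X, ∀ b ∈ X, ∃ c ∈ X, Contained a c ∧ Contained b c
  swap
  · -- Every member of `X` avoids `a` or avoids `b`, so one colour suffices for each.
    push Not at hdir
    obtain ⟨a, ha, b, hb, hab⟩ := hdir
    refine splittableOver_trans (ι := Bool) (fun i => X ∩ Av {cond i a b})
      (fun i => hav' _ (by cases i <;> assumption)) fun π hπ => ?_
    have hempty : ∀ i : Bool, ⟨0, 1⟩ ∈ X ∩ Av {cond i a b} := fun i =>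
      ⟨h0, mem_av_singleton.2 fun h => by
        have h' := eq_empty_of_size (Nat.le_zero.1 h.size_le)
        cases i
        · exact hab a ha (.refl a) (by simp at h'; rw [h']; exact contained_empty _)
        · exact hab b hb (by simp at h'; rw [h']; exact contained_empty _) (.refl b)⟩
    obtain ⟨i, hi⟩ : ∃ i : Bool, ¬ Contained (cond i a b) π := by
      by_cases haπ : Contained a π
      · exact ⟨false, hab π hπ haπ⟩
      · exact ⟨true, haπ⟩
    refine ⟨_, fun j => ?_, split_single π i⟩
    by_cases hj : j = i
    · subst hj
      simpa using ⟨hπ, mem_av_singleton.2 hi⟩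
    · rw [Function.update_of_ne hj]
      exact hempty j
  have hsquare : ∀ s, (¬ ∀ a ∈ X, ∀ b ∈ X, op s a b ∈ X) → ∃ c ∈ X, op s c c ∉ X := by
    intro s hs
    push Not at hs
    obtain ⟨a, ha, b, hb, hab⟩ := hs
    obtain ⟨c, hc, hac, hbc⟩ := hdir a ha b hb
    exact ⟨c, hc, fun h => hab (hX _ h _ (hac.op hbc))⟩
  by_cases hcl : ∃ s, ∀ a ∈ X, ∀ b ∈ X, op s a b ∈ X
  · obtain ⟨s, hs⟩ := hcl
    obtain ⟨c, hc, hcc⟩ : ∃ c ∈ X, op (!s) c c ∉ X := by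
      refine hsquare _ fun hs' => hXS.not_subset fun π hπ => ?_
      refine IsSeparable.op_induction (P := fun π => π ∈ X) h0 h1 (fun t a b _ _ ha hb => ?_) hπ
      by_cases hts : t = s
      · exact hts ▸ hs a ha b hb
      · obtain rfl : t = !s := Bool.eq_not_iff.2 hts
        exact hs' a ha b hb
    let L : Permutation → Set Permutation := fun γ => {τ | τ ∈ X ∧ op (!s) τ γ ∈ X}
    let R : Permutation → Set Permutation := fun γ => {τ | τ ∈ X ∧ op (!s) γ τ ∈ X}
    have hL : ∀ γ, IsPermClass (L γ) := fun γ τ hτ σ hσ =>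
      ⟨hX _ hτ.1 _ hσ, hX _ hτ.2 _ (hσ.op (.refl γ))⟩
    have hR : ∀ γ, IsPermClass (R γ) := fun γ τ hτ σ hσ =>
      ⟨hX _ hτ.1 _ hσ, hX _ hτ.2 _ ((Contained.refl γ).op hσ)⟩
    obtain ⟨l, hl, hlmin⟩ := exists_forall_subset (F := L) ⟨_, h0⟩ hdir
      (fun γ _ => ⟨hL γ, fun τ hτ => hXS.subset hτ.1⟩)
      fun γ γ' h τ hτ => ⟨hτ.1, hX _ hτ.2 _ ((Contained.refl τ).op h)⟩
    obtain ⟨r, hr, hrmin⟩ := exists_forall_subset (F := R) ⟨_, h0⟩ hdir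
      (fun γ _ => ⟨hR γ, fun τ hτ => hXS.subset hτ.1⟩)
      fun γ γ' h τ hτ => ⟨hτ.1, hX _ hτ.2 _ (h.op (.refl τ))⟩
    obtain ⟨m, hm, hlm, hrm⟩ := hdir l hl r hr
    obtain ⟨α, hα, hmα, h2α⟩ := hdir m hm _ (hs _ h1 _ h1)
    have hα2 : 2 ≤ α.1 := by
      have := h2α.size_le
      rwa [op_size] at this
    have hLX : L l ⊂ X :=
      (show _ ⊆ X from fun τ hτ => hτ.1).ssubset_of_mem_notMem hc fun h => hcc (hlmin c hc h).2
    have hRX : R r ⊂ X :=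
      (show _ ⊆ X from fun τ hτ => hτ.1).ssubset_of_mem_notMem hc fun h => hcc (hrmin c hc h).2
    exact splittableOver_of_closed (L := L l) (R := R r) hX hXS.subset hs hα hα2
      (fun τ hτ h => ⟨hτ, hX _ h _ ((Contained.refl τ).op (hlm.trans hmα))⟩)
      (fun τ hτ h => ⟨hτ, hX _ h _ ((hrm.trans hmα).op (.refl τ))⟩)
      (fun τ hτ γ hγ => (hlmin γ hγ hτ).2) (fun τ hτ γ hγ => (hrmin γ hγ hτ).2)
      (ih _ (hL l) hLX) (ih _ (hR r) hRX) (hav α hα)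
  · push Not at hcl
    obtain ⟨c, hc, hcc⟩ := hsquare true (by push Not; exact hcl true)
    obtain ⟨d, hd, hdd⟩ := hsquare false (by push Not; exact hcl false)
    obtain ⟨α, hα, hcα, hdα⟩ := hdir c hc d hd
    have hαα : ∀ s, op s α α ∉ X := by
      rintro (_ | _) h
      · exact hdd (hX _ h _ (hdα.op hdα))
      · exact hcc (hX _ h _ (hcα.op hcα))
    refine splittableOver_of_not_closed hX hXS.subset (fun h => ?_) hαα (hav' α hα) huni
    refine hαα true ?_
    rw [eq_empty_of_size h, op_empty]
    exact h0

end PermClass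

theorem mainTheorem4 (X : Set PermClass.Permutation) (hX : PermClass.IsPermClass X)
    (hXSep : X ⊂ PermClass.SepClass) :
    PermClass.SplittableOver {Y | PermClass.Representable Y ∧ Y ⊆ X} X := by
  have key : ∀ C : {X : Set PermClass.Permutation // PermClass.IsPermClass X ∧
      X ⊆ PermClass.SepClass}, C.1 ⊂ PermClass.SepClass →
      PermClass.SplittableOver (PermClass.repSubclasses C.1) C.1 := by
    intro C
    induction C using PermClass.wellFounded_subclasses.induction with
    | _ C ih =>
      intro hC
      exact PermClass.splittableOver_of_subclasses C.2.1 hC fun Y hY hYC =>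
        ih ⟨Y, hY, hYC.subset.trans C.2.2⟩ hYC (hYC.trans_subset hC.subset)
  exact key ⟨X, hX, hXSep.subset⟩ hXSep
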